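/- **Setting.** Fix a vocabulary of predicate symbols $P/n$ and function symbols, and an infinite set of object symbols. Free object symbols act as constants, and every object symbol can be quantified. Expressions are identified up to renaming of bound object symbols, so that substitution is always safe. Atoms are $\top$, $\bot$, $P(\bar t)$ and $t=s$ (equality is a logical symbol). FO-formulas are built from atoms with $\lnot,\land,\lor,\Rightarrow,\Leftrightarrow,\forall,\exists$. A *definition* $\Phi$ is a finite set of rules $\forall\bar x: P(\bar t)\leftarrow\varphi$ with $\varphi$ an FO-formula, and $\mathrm{Def}(\Phi)$ is the set of predicate symbols in the heads of its rules. FO(ID)-formulas are built from atoms and definitions with the same connectives and quantifiers. An occurrence in a formula is *positive* if it lies in the scope of an even number of negations, and *negative* otherwise, where $\varphi\Rightarrow\psi$ is read as $\lnot\varphi\lor\psi$ and $\varphi\Leftrightarrow\psi$ as $(\varphi\Rightarrow\psi)\land(\psi\Rightarrow\varphi)$. A *propositional formula* is built from $\top$, $\bot$ and $0$-ary predicate symbols with $\lnot,\land,\lor,\Rightarrow,\Leftrightarrow$. A *propositional definition* is a definition in which all predicate symbols are $0$-ary. **Stable semantics.** Let $\mathcal I$ be a structure with non-empty domain, $\Phi$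 a definition, and $\mathcal S$ the set of structures that differ from $\mathcal I$ at most on $\mathrm{Def}(\Phi)$, ordered by inclusion of the interpretations of the predicates in $\mathrm{Def}(\Phi)$. For $\mathcal J,\mathcal K\in\mathcal S$ let $\mathcal C(\mathcal J,\mathcal K)\in\mathcal S$ be the structure in which $P(\bar a)$, for $P\in\mathrm{Def}(\Phi)$, is true iff for some rule $\forall\bar x:P(\bar t)\leftarrow\varphi$ of $\Phi$ the formula $\exists\bar x:\bar a=\bar t\land\varphi$ is true when the positive occurrences of predicates in $\mathrm{Def}(\Phi)$ are interpreted by $\mathcal J$ and the negative ones by $\mathcal K$. Then $\mathcal I\models_{\mathrm{st}}\Phi$ iff $\mathcal I$ is the least fixpoint of $\mathcal C(\cdot,\mathcal I)$. The relation $\models_{\mathrm{st}}$ is extended to all FO(ID)-formulas by the usual clauses. A sequent $\Gamma\vdash\Delta$ of sets of FO(ID)-formulas is *valid under the stable semantics* if every structure that satisfies all formulas in $\Gamma$ satisfies some formula in $\Delta$. **The calculus $\mathrm{SC}_{\mathrm{FO(ID)}}$.** Its rules are as follows. * Structural rules: the axioms $\Gamma\vdash\Delta$ with $\Gamma\cap\Delta\ne\emptyset$,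 $\bot\in\Gamma$ or $\top\in\Delta$; weakening; substitution (from $\Gamma\vdash\Delta$ infer $\Gamma[t/x]\vdash\Delta[t/x]$); and cut. * The usual left and right rules of Gentzen's classical sequent calculus for $\lnot,\land,\lor,\Rightarrow,\Leftrightarrow,\forall,\exists$ (sequents being pairs of sets). * Equality: $\Gamma\vdash t=t,\Delta$; and from $\Gamma[s/x,t/y]\vdash\Delta[s/x,t/y]$ infer $\Gamma[t/x,s/y],\,t=s\vdash\Delta[t/x,s/y]$. * (def R): for a rule $\forall\bar x:P(\bar t)\leftarrow\varphi$ of $\Phi$ and a tuple $\bar s$ of object symbols, from $\Gamma,\Phi\vdash\varphi[\bar s/\bar x],\Delta$ infer $\Gamma,\Phi\vdash P(\bar t[\bar s/\bar x]),\Delta$. * (def L): for $P\in\Pi\subseteq\mathrm{Def}(\Phi)$ and FO-formulas $F_Q[\bar z]$ for $Q\in\Pi$, infer $\Gamma,\Phi,P(\bar v)\vdash\Delta$ from $\Gamma,\Phi,F_P[\bar v]\vdash\Delta$ and the sequents $\Gamma,\Phi,\psi[F_\Pi/\Pi^+]\vdash F_Q[\bar s],\Delta$ for all rules $\forall\bar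 y:Q(\bar s)\leftarrow\psi$ of $\Phi$ with $Q\in\Pi$. Here $\psi[F_\Pi/\Pi^+]$ results from $\psi$ by replacing each positive occurrence of an atom $R(\bar u)$ with $R\in\Pi$ by $F_R[\bar u]$, and the object symbols $\bar y$ are distinct and occur freely neither in $\Gamma$, $\Delta$, $\Phi$ nor (apart from $\bar z$) in the formulas $F_R$, $R\in\Pi$. A sequent is *provable* if it has a finite proof. **Theorem (Propositional completeness).** Let $\Gamma$ and $\Delta$ be (finite or infinite) sets of propositional formulas and $\Phi_1,\dots,\Phi_n$ propositional definitions. If $\Gamma,\Phi_1,\dots,\Phi_n\vdash\Delta$ is valid under the stable semantics, then it is provable in $\mathrm{SC}_{\mathrm{FO(ID)}}$. -/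

import Mathlib

universe u v w x

namespace FOID

/-! ## Terms

The vocabulary is given by a first-order language `L` (function symbols and predicate symbols of
every arity; the predicate symbols of arity `0` are the propositional symbols) and a type `α` of
object symbols. Free object symbols act as constants, and any object symbol can be quantified.

Bound object symbols are represented by positions: an expression at level `n` stands under `n`
binders and its terms are elements of `L.Term (α ⊕ Fin n)`, where `Sum.inl a` is the (free) object
symbol `a` and `Sum.inr i` is the object symbol bound by the `i`-th enclosing binder, counted from
the outside. So expressions are taken up to renaming of bound object symbols, and substitution is
always safe. Expressions proper are those at level `0`. -/

/-- The object symbol `a` as a term. -/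
def obj {L : FirstOrder.Language.{u, v}} {α : Type w} {n : ℕ} (a : α) : L.Term (α ⊕ Fin n) :=
  FirstOrder.Language.Term.var (Sum.inl a)

/-- The `i`-th bound object symbol as a term. -/
def bd {L : FirstOrder.Language.{u, v}} {α : Type w} {n : ℕ} (i : Fin n) : L.Term (α ⊕ Fin n) :=
  FirstOrder.Language.Term.var (Sum.inr i)

/-- The set of object symbols that occur freely in a term. -/
def termFree {L : FirstOrder.Language.{u, v}} {α : Type w} {n : ℕ} :
    L.Term (α ⊕ Fin n) → Set α
  | .var (Sum.inl a) => {a}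
  | .var (Sum.inr _) => ∅
  | .func _ ts => ⋃ i, termFree (ts i)

/-- A substitution of terms at level `m` for the free and bound object symbols of expressions at
level `n`. -/
abbrev Subst (L : FirstOrder.Language.{u, v}) (α : Type w) (n m : ℕ) : Type (max u w) :=
  α ⊕ Fin n → L.Term (α ⊕ Fin m)

/-- The substitution to be applied under `k` further binders. -/
def Subst.lift {L : FirstOrder.Language.{u, v}} {α : Type w} {n m : ℕ} (σ : Subst L α n m)
    (k : ℕ) : Subst L α (n + k) (m + k) :=
  Sum.elim (fun a => (σ (Sum.inl a)).relabel (Sum.map id (Fin.castAdd k)))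
    (Fin.addCases (fun i => (σ (Sum.inr i)).relabel (Sum.map id (Fin.castAdd k)))
      (fun j => bd (Fin.natAdd m j)))

/-- `[τ a / a]` for all object symbols `a` simultaneously. -/
def Subst.ofObj {L : FirstOrder.Language.{u, v}} {α : Type w} {n : ℕ}
    (τ : α → L.Term (α ⊕ Fin n)) : Subst L α n n :=
  Sum.elim τ bd

/-- Substitution of `s` for the `k` innermost bound object symbols. -/
def Subst.inst {L : FirstOrder.Language.{u, v}} {α : Type w} {n k : ℕ}
    (s : Fin k → L.Term (α ⊕ Fin n)) : Subst L α (n + k) n :=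
  Sum.elim obj (Fin.addCases bd s)

/-- Substitution of `s` for all `k` bound object symbols of an expression at level `k`. -/
def Subst.fill {L : FirstOrder.Language.{u, v}} {α : Type w} {n k : ℕ}
    (s : Fin k → L.Term (α ⊕ Fin n)) : Subst L α k n :=
  Sum.elim obj s

open Classical in
/-- The map `[t / x]` on object symbols. -/
noncomputable def single {L : FirstOrder.Language.{u, v}} {α : Type w}
    (x : α) (t : L.Term (α ⊕ Fin 0)) : α → L.Term (α ⊕ Fin 0) :=
  Function.update obj x t

open Classical in
/-- The map `[s / x, t / y]` on (distinct) object symbols. -/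
noncomputable def double {L : FirstOrder.Language.{u, v}} {α : Type w}
    (x : α) (s : L.Term (α ⊕ Fin 0)) (y : α) (t : L.Term (α ⊕ Fin 0)) :
    α → L.Term (α ⊕ Fin 0) :=
  Function.update (Function.update obj x s) y t

/-! ## Formulas and definitions -/

/-- Formulas at level `n`, built from atoms and from further basic formulas `d : D n` with the
propositional connectives and the quantifiers. -/
inductive Formula (L : FirstOrder.Language.{u, v}) (α : Type w) (D : ℕ → Type x) :
    ℕ → Type (max u v w x)
  | top {n : ℕ} : Formula L α D n
  | bot {n : ℕ} : Formula L α D n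
  | rel {n k : ℕ} (P : L.Relations k) (ts : Fin k → L.Term (α ⊕ Fin n)) : Formula L α D n
  | eq {n : ℕ} (t s : L.Term (α ⊕ Fin n)) : Formula L α D n
  | neg {n : ℕ} (φ : Formula L α D n) : Formula L α D n
  | and {n : ℕ} (φ ψ : Formula L α D n) : Formula L α D n
  | or {n : ℕ} (φ ψ : Formula L α D n) : Formula L α D n
  | imp {n : ℕ} (φ ψ : Formula L α D n) : Formula L α D n
  | iff {n : ℕ} (φ ψ : Formula L α D n) : Formula L α D n
  | all {n : ℕ} (φ : Formula L α D (n + 1)) : Formula L α D n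
  | ex {n : ℕ} (φ : Formula L α D (n + 1)) : Formula L α D n
  | defn {n : ℕ} (d : D n) : Formula L α D n

namespace Formula

variable {L : FirstOrder.Language.{u, v}} {α : Type w} {D : ℕ → Type x}

/-- Object symbols that occur freely, given those of the further basic formulas. -/
def free (fD : ∀ {n : ℕ}, D n → Set α) : {n : ℕ} → Formula L α D n → Set α
  | _, top => ∅
  | _, bot => ∅
  | _, rel _ ts => ⋃ i, termFree (ts i)
  | _, eq t s => termFree t ∪ termFree s
  | _, neg φ => φ.free fD
  | _, and φ ψ => φ.free fD ∪ ψ.free fD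
  | _, or φ ψ => φ.free fD ∪ ψ.free fD
  | _, imp φ ψ => φ.free fD ∪ ψ.free fD
  | _, iff φ ψ => φ.free fD ∪ ψ.free fD
  | _, all φ => φ.free fD
  | _, ex φ => φ.free fD
  | _, defn d => fD d

/-- Substitution, given substitution in the further basic formulas. -/
def subst (sD : ∀ {n m : ℕ}, Subst L α n m → D n → D m) :
    {n m : ℕ} → Subst L α n m → Formula L α D n → Formula L α D m
  | _, _, _, top => top
  | _, _, _, bot => bot
  | _, _, σ, rel P ts => rel P (fun i => (ts i).subst σ)
  | _, _, σ, eq t s => eq (t.subst σ) (s.subst σ)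
  | _, _, σ, neg φ => neg (φ.subst sD σ)
  | _, _, σ, and φ ψ => and (φ.subst sD σ) (ψ.subst sD σ)
  | _, _, σ, or φ ψ => or (φ.subst sD σ) (ψ.subst sD σ)
  | _, _, σ, imp φ ψ => imp (φ.subst sD σ) (ψ.subst sD σ)
  | _, _, σ, iff φ ψ => iff (φ.subst sD σ) (ψ.subst sD σ)
  | _, _, σ, all φ => all (φ.subst sD (σ.lift 1))
  | _, _, σ, ex φ => ex (φ.subst sD (σ.lift 1))
  | _, _, σ, defn d => defn (sD σ d)

/-- The formula has only predicate symbols of arity `0`. (Equality is a logical symbol.) -/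
def NullaryPreds : {n : ℕ} → Formula L α D n → Prop
  | _, top => True
  | _, bot => True
  | _, rel (k := k) _ _ => k = 0
  | _, eq _ _ => True
  | _, neg φ => φ.NullaryPreds
  | _, and φ ψ => φ.NullaryPreds ∧ ψ.NullaryPreds
  | _, or φ ψ => φ.NullaryPreds ∧ ψ.NullaryPreds
  | _, imp φ ψ => φ.NullaryPreds ∧ ψ.NullaryPreds
  | _, iff φ ψ => φ.NullaryPreds ∧ ψ.NullaryPreds
  | _, all φ => φ.NullaryPreds
  | _, ex φ => φ.NullaryPreds
  | _, defn _ => False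

/-- Propositional formulas: built from `⊤`, `⊥` and propositional symbols with the propositional
connectives. -/
def IsPropositional : {n : ℕ} → Formula L α D n → Prop
  | _, top => True
  | _, bot => True
  | _, rel (k := k) _ _ => k = 0
  | _, eq _ _ => False
  | _, neg φ => φ.IsPropositional
  | _, and φ ψ => φ.IsPropositional ∧ ψ.IsPropositional
  | _, or φ ψ => φ.IsPropositional ∧ ψ.IsPropositional
  | _, imp φ ψ => φ.IsPropositional ∧ ψ.IsPropositional
  | _, iff φ ψ => φ.IsPropositional ∧ ψ.IsPropositional
  | _, all _ => False
  | _, ex _ => False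
  | _, defn _ => False

end Formula

/-- First-order formulas: no further basic formulas. -/
abbrev FO (L : FirstOrder.Language.{u, v}) (α : Type w) (n : ℕ) : Type (max u v w) :=
  Formula L α (fun _ => Empty) n

/-- The predicate symbols of all arities. -/
abbrev PredSym (L : FirstOrder.Language.{u, v}) : Type v := Σ k : ℕ, L.Relations k

/-- A definitional rule `∀ x₁ … x_k : P(t̄) ← φ`; the object symbols `x₁, …, x_k` are the
`k = numVars` innermost bound ones. -/
structure Rule (L : FirstOrder.Language.{u, v}) (α : Type w) (n : ℕ) : Type (max u v w) where
  numVars : ℕ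
  arity : ℕ
  pred : L.Relations arity
  args : Fin arity → L.Term (α ⊕ Fin (n + numVars))
  body : FO L α (n + numVars)

/-- A definition is a finite set of definitional rules. -/
abbrev Definition (L : FirstOrder.Language.{u, v}) (α : Type w) (n : ℕ) : Type (max u v w) :=
  Finset (Rule L α n)

/-- FO(ID)-formulas: built from atoms and definitions. -/
abbrev IDFormula (L : FirstOrder.Language.{u, v}) (α : Type w) (n : ℕ) : Type (max u v w) :=
  Formula L α (fun n => Definition L α n) n

section Operations

variable {L : FirstOrder.Language.{u, v}} {α : Type w}

def FO.free {n : ℕ} (φ : FO L α n) : Set α :=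
  Formula.free (fun d => d.elim) φ

def FO.subst {n m : ℕ} (σ : Subst L α n m) (φ : FO L α n) : FO L α m :=
  Formula.subst (fun _ d => d.elim) σ φ

/-- A first-order formula as an FO(ID)-formula. -/
def FO.toID : {n : ℕ} → FO L α n → IDFormula L α n
  | _, .top => .top
  | _, .bot => .bot
  | _, .rel P ts => .rel P ts
  | _, .eq t s => .eq t s
  | _, .neg φ => .neg (FO.toID φ)
  | _, .and φ ψ => .and (FO.toID φ) (FO.toID ψ)
  | _, .or φ ψ => .or (FO.toID φ) (FO.toID ψ)
  | _, .imp φ ψ => .imp (FO.toID φ) (FO.toID ψ)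
  | _, .iff φ ψ => .iff (FO.toID φ) (FO.toID ψ)
  | _, .all φ => .all (FO.toID φ)
  | _, .ex φ => .ex (FO.toID φ)
  | _, .defn d => d.elim

/-- The predicate symbol in the head of a rule. -/
def Rule.sym {n : ℕ} (r : Rule L α n) : PredSym L := ⟨r.arity, r.pred⟩

def Rule.free {n : ℕ} (r : Rule L α n) : Set α :=
  (⋃ i, termFree (r.args i)) ∪ FO.free r.body

def Rule.subst {n m : ℕ} (σ : Subst L α n m) (r : Rule L α n) : Rule L α m where
  numVars := r.numVars
  arity := r.arity
  pred := r.pred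
  args := fun i => (r.args i).subst (σ.lift r.numVars)
  body := FO.subst (σ.lift r.numVars) r.body

/-- The set of defined predicates. -/
def Definition.defined {n : ℕ} (Φ : Definition L α n) : Set (PredSym L) :=
  {p | ∃ r ∈ Φ, r.sym = p}

def Definition.free {n : ℕ} (Φ : Definition L α n) : Set α :=
  ⋃ r ∈ Φ, Rule.free r

open Classical in
noncomputable def Definition.subst {n m : ℕ} (σ : Subst L α n m) (Φ : Definition L α n) :
    Definition L α m :=
  Finset.image (Rule.subst σ) Φ

/-- Propositional definitions: all predicate symbols, in heads and bodies, have arity `0`. -/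
def Definition.IsPropositional {n : ℕ} (Φ : Definition L α n) : Prop :=
  ∀ r ∈ Φ, r.arity = 0 ∧ r.body.NullaryPreds

def IDFormula.free {n : ℕ} (φ : IDFormula L α n) : Set α :=
  Formula.free (fun Φ => Definition.free Φ) φ

noncomputable def IDFormula.subst {n m : ℕ} (σ : Subst L α n m) (φ : IDFormula L α n) :
    IDFormula L α m :=
  Formula.subst (fun σ Φ => Definition.subst σ Φ) σ φ

/-- The object symbols that occur freely in some element of a set of formulas. -/
def freeSet (Γ : Set (IDFormula L α 0)) : Set α :=
  ⋃ φ ∈ Γ, IDFormula.free φ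

/-- The simultaneous substitution of `τ a` for all object symbols `a` in a set of formulas. -/
noncomputable def substSet (τ : α → L.Term (α ⊕ Fin 0)) (Γ : Set (IDFormula L α 0)) :
    Set (IDFormula L α 0) :=
  IDFormula.subst (Subst.ofObj τ) '' Γ

open Classical in
/-- `replacePos S F true ψ` is `ψ[F_S / S⁺]`: every positive occurrence of an atom `R(ū)` with
`R ∈ S` is replaced by `F_R[ū]`. (`replacePos S F false ψ` does so with the negative occurrences.)
Here `F_R[z̄]` is a formula at level `k`, the arity of `R`, with `z̄` its bound object symbols.
Biconditionals are unwound into two implications. -/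
noncomputable def FO.replacePos (S : Set (PredSym L))
    (F : ∀ {k : ℕ}, L.Relations k → FO L α k) : {n : ℕ} → Bool → FO L α n → FO L α n
  | _, _, .top => .top
  | _, _, .bot => .bot
  | _, b, .rel (k := k) R ts =>
      if b = true ∧ (⟨k, R⟩ : PredSym L) ∈ S then FO.subst (Subst.fill ts) (F R) else .rel R ts
  | _, _, .eq t s => .eq t s
  | _, b, .neg φ => .neg (FO.replacePos S F (!b) φ)
  | _, b, .and φ ψ => .and (FO.replacePos S F b φ) (FO.replacePos S F b ψ)
  | _, b, .or φ ψ => .or (FO.replacePos S F b φ) (FO.replacePos S F b ψ)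
  | _, b, .imp φ ψ => .imp (FO.replacePos S F (!b) φ) (FO.replacePos S F b ψ)
  | _, b, .iff φ ψ =>
      .and (.imp (FO.replacePos S F (!b) φ) (FO.replacePos S F b ψ))
        (.imp (FO.replacePos S F (!b) ψ) (FO.replacePos S F b φ))
  | _, b, .all φ => .all (FO.replacePos S F b φ)
  | _, b, .ex φ => .ex (FO.replacePos S F b φ)
  | _, _, .defn d => d.elim

end Operations

/-! ## The stable semantics

A structure is given by a non-empty type `M` with `[L.Structure M]` and by an interpretation
`v : α → M` of the object symbols. The elements `xs : Fin n → M` interpret the bound object symbols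
of expressions at level `n`. -/

/-- Interpretations of the predicate symbols in `M`, ordered by pointwise inclusion. -/
abbrev PredInt (L : FirstOrder.Language.{u, v}) (M : Type x) : Type (max v x) :=
  ∀ k : ℕ, L.Relations k → (Fin k → M) → Prop

section Semantics

variable {L : FirstOrder.Language.{u, v}} {α : Type w} {M : Type x} [L.Structure M]

/-- The value of a term. -/
def termVal {n : ℕ} (v : α → M) (xs : Fin n → M) (t : L.Term (α ⊕ Fin n)) : M :=
  t.realize (Sum.elim v xs)

/-- Truth of a first-order formula when predicate symbols are interpreted by `I` at their positive
occurrences and by `J` at their negative ones. -/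
def FO.Holds (v : α → M) :
    {n : ℕ} → (I J : PredInt L M) → FO L α n → (Fin n → M) → Prop
  | _, _, _, .top, _ => True
  | _, _, _, .bot, _ => False
  | _, I, _, .rel P ts, xs => I _ P (fun i => termVal v xs (ts i))
  | _, _, _, .eq t s, xs => termVal v xs t = termVal v xs s
  | _, I, J, .neg φ, xs => ¬ FO.Holds v J I φ xs
  | _, I, J, .and φ ψ, xs => FO.Holds v I J φ xs ∧ FO.Holds v I J ψ xs
  | _, I, J, .or φ ψ, xs => FO.Holds v I J φ xs ∨ FO.Holds v I J ψ xs
  | _, I, J, .imp φ ψ, xs => FO.Holds v J I φ xs → FO.Holds v I J ψ xs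
  | _, I, J, .iff φ ψ, xs =>
      (FO.Holds v J I φ xs → FO.Holds v I J ψ xs) ∧ (FO.Holds v J I ψ xs → FO.Holds v I J φ xs)
  | _, I, J, .all φ, xs => ∀ a : M, FO.Holds v I J φ (Fin.snoc xs a)
  | _, I, J, .ex φ, xs => ∃ a : M, FO.Holds v I J φ (Fin.snoc xs a)
  | _, _, _, .defn d, _ => d.elim

/-- Truth of the merged body of `P(ā)` in `Φ`, the disjunction of `∃ x̄ : ā = t̄ ∧ φ` over the rules
`∀ x̄ : P(t̄) ← φ` of `Φ`, with positive occurrences interpreted by `I`, negative ones by `J`. -/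
def Definition.MergedBody {n : ℕ} (Φ : Definition L α n) (v : α → M) (xs : Fin n → M)
    (I J : PredInt L M) (k : ℕ) (P : L.Relations k) (a : Fin k → M) : Prop :=
  ∃ (numVars : ℕ) (args : Fin k → L.Term (α ⊕ Fin (n + numVars))) (body : FO L α (n + numVars)),
    (⟨numVars, k, P, args, body⟩ : Rule L α n) ∈ Φ ∧
    ∃ b : Fin numVars → M, (∀ i, a i = termVal v (Fin.append xs b) (args i)) ∧
      FO.Holds v I J body (Fin.append xs b)

/-- `K` and `I` interpret all symbols but the defined predicates of `Φ` in the same way. -/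
def Definition.SameContext {n : ℕ} (Φ : Definition L α n) (K I : PredInt L M) : Prop :=
  ∀ (k : ℕ) (P : L.Relations k), (⟨k, P⟩ : PredSym L) ∉ Φ.defined → K k P = I k P

/-- The operator `C` of `Φ`: the defined predicates are reinterpreted by their merged bodies, the
other symbols keep their interpretation, which is the same in `I` and `J` when both expand the same
context. -/
def Definition.stepOp {n : ℕ} (Φ : Definition L α n) (v : α → M) (xs : Fin n → M)
    (I J : PredInt L M) : PredInt L M := fun k P a =>
  ((⟨k, P⟩ : PredSym L) ∈ Φ.defined ∧ Φ.MergedBody v xs I J k P a) ∨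
    ((⟨k, P⟩ : PredSym L) ∉ Φ.defined ∧ J k P a)

/-- `I` is a stable model of `Φ` in its restriction to the parameters of `Φ`: among the structures
in that context, `I` is the least fixpoint of `C(·, I)`. -/
def Definition.IsStable {n : ℕ} (Φ : Definition L α n) (v : α → M) (xs : Fin n → M)
    (I : PredInt L M) : Prop :=
  IsLeast {K : PredInt L M | Φ.SameContext K I ∧ Φ.stepOp v xs K I = K} I

/-- The interpretation of the predicate symbols in the structure `M`. -/
def predInt (L : FirstOrder.Language.{u, v}) (M : Type x) [L.Structure M] : PredInt L M :=
  fun _ P a => FirstOrder.Language.Structure.RelMap P a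

/-- The stable satisfaction relation. -/
def IDFormula.Sat (v : α → M) : {n : ℕ} → IDFormula L α n → (Fin n → M) → Prop
  | _, .top, _ => True
  | _, .bot, _ => False
  | _, .rel P ts, xs => predInt L M _ P (fun i => termVal v xs (ts i))
  | _, .eq t s, xs => termVal v xs t = termVal v xs s
  | _, .neg φ, xs => ¬ IDFormula.Sat v φ xs
  | _, .and φ ψ, xs => IDFormula.Sat v φ xs ∧ IDFormula.Sat v ψ xs
  | _, .or φ ψ, xs => IDFormula.Sat v φ xs ∨ IDFormula.Sat v ψ xs
  | _, .imp φ ψ, xs => IDFormula.Sat v φ xs → IDFormula.Sat v ψ xs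
  | _, .iff φ ψ, xs => IDFormula.Sat v φ xs ↔ IDFormula.Sat v ψ xs
  | _, .all φ, xs => ∀ a : M, IDFormula.Sat v φ (Fin.snoc xs a)
  | _, .ex φ, xs => ∃ a : M, IDFormula.Sat v φ (Fin.snoc xs a)
  | _, .defn Φ, xs => Φ.IsStable v xs (predInt L M)

end Semantics

/-- Validity of the sequent `Γ ⊢ Δ` under the stable semantics. -/
def StableValid {L : FirstOrder.Language.{u, v}} {α : Type w} (Γ Δ : Set (IDFormula L α 0)) :
    Prop :=
  ∀ (M : Type (max u v w)) [Nonempty M] [L.Structure M] (v : α → M),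
    (∀ φ ∈ Γ, IDFormula.Sat v φ Fin.elim0) → ∃ φ ∈ Δ, IDFormula.Sat v φ Fin.elim0

/-! ## The sequent calculus -/

/-- Provability of the sequent `Γ ⊢ Δ` in the sequent calculus for FO(ID). A premise or conclusion
written `Γ, φ ⊢ Δ` is the sequent `insert φ Γ ⊢ Δ`. -/
inductive Provable {L : FirstOrder.Language.{u, v}} {α : Type w} :
    Set (IDFormula L α 0) → Set (IDFormula L α 0) → Prop
  | ax {Γ Δ : Set (IDFormula L α 0)}
      (h : (Γ ∩ Δ).Nonempty ∨ Formula.bot ∈ Γ ∨ Formula.top ∈ Δ) : Provable Γ Δ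
  | wk {Γ Δ Γ' Δ' : Set (IDFormula L α 0)} (hΓ : Γ' ⊆ Γ) (hΔ : Δ' ⊆ Δ)
      (h : Provable Γ' Δ') : Provable Γ Δ
  | subst {Γ Δ : Set (IDFormula L α 0)} (x : α) (t : L.Term (α ⊕ Fin 0))
      (h : Provable Γ Δ) : Provable (substSet (single x t) Γ) (substSet (single x t) Δ)
  | cut {Γ Δ : Set (IDFormula L α 0)} (φ : IDFormula L α 0)
      (h₁ : Provable Γ (insert φ Δ)) (h₂ : Provable (insert φ Γ) Δ) : Provable Γ Δ
  | negL {Γ Δ : Set (IDFormula L α 0)} {φ : IDFormula L α 0}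
      (h : Provable Γ (insert φ Δ)) : Provable (insert (.neg φ) Γ) Δ
  | negR {Γ Δ : Set (IDFormula L α 0)} {φ : IDFormula L α 0}
      (h : Provable (insert φ Γ) Δ) : Provable Γ (insert (.neg φ) Δ)
  | orL {Γ Δ : Set (IDFormula L α 0)} {φ ψ : IDFormula L α 0}
      (h₁ : Provable (insert φ Γ) Δ) (h₂ : Provable (insert ψ Γ) Δ) :
      Provable (insert (.or φ ψ) Γ) Δ
  | orR {Γ Δ : Set (IDFormula L α 0)} {φ ψ : IDFormula L α 0}
      (h : Provable Γ (insert φ (insert ψ Δ))) : Provable Γ (insert (.or φ ψ) Δ)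
  | andL {Γ Δ : Set (IDFormula L α 0)} {φ ψ : IDFormula L α 0}
      (h : Provable (insert φ (insert ψ Γ)) Δ) : Provable (insert (.and φ ψ) Γ) Δ
  | andR {Γ Δ : Set (IDFormula L α 0)} {φ ψ : IDFormula L α 0}
      (h₁ : Provable Γ (insert φ Δ)) (h₂ : Provable Γ (insert ψ Δ)) :
      Provable Γ (insert (.and φ ψ) Δ)
  | impL {Γ Δ : Set (IDFormula L α 0)} {φ ψ : IDFormula L α 0}
      (h₁ : Provable Γ (insert φ Δ)) (h₂ : Provable (insert ψ Γ) Δ) :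
      Provable (insert (.imp φ ψ) Γ) Δ
  | impR {Γ Δ : Set (IDFormula L α 0)} {φ ψ : IDFormula L α 0}
      (h : Provable (insert φ Γ) (insert ψ Δ)) : Provable Γ (insert (.imp φ ψ) Δ)
  | iffL {Γ Δ : Set (IDFormula L α 0)} {φ ψ : IDFormula L α 0}
      (h₁ : Provable Γ (insert φ (insert ψ Δ))) (h₂ : Provable (insert φ (insert ψ Γ)) Δ) :
      Provable (insert (.iff φ ψ) Γ) Δ
  | iffR {Γ Δ : Set (IDFormula L α 0)} {φ ψ : IDFormula L α 0}
      (h₁ : Provable (insert φ Γ) (insert ψ Δ)) (h₂ : Provable (insert ψ Γ) (insert φ Δ)) :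
      Provable Γ (insert (.iff φ ψ) Δ)
  | allL {Γ Δ : Set (IDFormula L α 0)} {φ : IDFormula L α 1} (t : L.Term (α ⊕ Fin 0))
      (h : Provable (insert (IDFormula.subst (Subst.inst (k := 1) fun _ => t) φ) Γ) Δ) :
      Provable (insert (.all φ) Γ) Δ
  | allR {Γ Δ : Set (IDFormula L α 0)} {φ : IDFormula L α 1} (x : α)
      (hx : x ∉ freeSet Γ ∪ freeSet Δ ∪ IDFormula.free φ)
      (h : Provable Γ (insert (IDFormula.subst (Subst.inst (k := 1) fun _ => obj x) φ) Δ)) :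
      Provable Γ (insert (.all φ) Δ)
  | exL {Γ Δ : Set (IDFormula L α 0)} {φ : IDFormula L α 1} (x : α)
      (hx : x ∉ freeSet Γ ∪ freeSet Δ ∪ IDFormula.free φ)
      (h : Provable (insert (IDFormula.subst (Subst.inst (k := 1) fun _ => obj x) φ) Γ) Δ) :
      Provable (insert (.ex φ) Γ) Δ
  | exR {Γ Δ : Set (IDFormula L α 0)} {φ : IDFormula L α 1} (t : L.Term (α ⊕ Fin 0))
      (h : Provable Γ (insert (IDFormula.subst (Subst.inst (k := 1) fun _ => t) φ) Δ)) :
      Provable Γ (insert (.ex φ) Δ)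
  | eqL {Γ Δ : Set (IDFormula L α 0)} {x y : α} (hxy : x ≠ y) (t s : L.Term (α ⊕ Fin 0))
      (h : Provable (substSet (double x s y t) Γ) (substSet (double x s y t) Δ)) :
      Provable (insert (.eq t s) (substSet (double x t y s) Γ)) (substSet (double x t y s) Δ)
  | eqR {Γ Δ : Set (IDFormula L α 0)} (t : L.Term (α ⊕ Fin 0)) :
      Provable Γ (insert (.eq t t) Δ)
  /-- Right introduction rule for defined atoms: `s̄` is a tuple of object symbols. -/
  | defR {Γ Δ : Set (IDFormula L α 0)} {Φ : Definition L α 0} {r : Rule L α 0} (hr : r ∈ Φ)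
      (s : Fin r.numVars → α)
      (h : Provable (insert (.defn Φ) Γ)
        (insert (FO.toID (FO.subst (Subst.inst fun i => obj (s i)) r.body)) Δ)) :
      Provable (insert (.defn Φ) Γ)
        (insert (.rel r.pred fun j => (r.args j).subst (Subst.inst fun i => obj (s i))) Δ)
  /-- Left introduction rule for defined atoms (induction): `S` is a set of defined predicates that
  contains `P`, and `F Q` is the induction hypothesis for `Q ∈ S`. The bound object symbols of each
  rule with head in `S` are named by a tuple `y r` of distinct fresh object symbols. -/
  | defL {Γ Δ : Set (IDFormula L α 0)} (Φ : Definition L α 0) (S : Set (PredSym L))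
      (hS : S ⊆ Φ.defined) (F : ∀ {k : ℕ}, L.Relations k → FO L α k)
      {k : ℕ} {P : L.Relations k} (hP : (⟨k, P⟩ : PredSym L) ∈ S)
      (args : Fin k → L.Term (α ⊕ Fin 0))
      (y : ∀ r : Rule L α 0, Fin r.numVars → α)
      (hinj : ∀ r ∈ Φ, r.sym ∈ S → Function.Injective (y r))
      (hfresh : ∀ r ∈ Φ, r.sym ∈ S → ∀ i, y r i ∉ freeSet Γ ∪ freeSet Δ ∪ Definition.free Φ)
      (hfreshF : ∀ r ∈ Φ, r.sym ∈ S → ∀ i, ∀ q ∈ S, y r i ∉ FO.free (F q.2))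
      (minor : ∀ r ∈ Φ, r.sym ∈ S →
        Provable
          (insert (FO.toID (FO.subst (Subst.inst fun i => obj (y r i))
            (FO.replacePos S F true r.body))) (insert (.defn Φ) Γ))
          (insert (FO.toID (FO.subst (Subst.fill fun j =>
            (r.args j).subst (Subst.inst fun i => obj (y r i))) (F r.pred))) Δ))
      (major : Provable
        (insert (FO.toID (FO.subst (Subst.fill args) (F P))) (insert (.defn Φ) Γ)) Δ) :
      Provable (insert (.rel P args) (insert (.defn Φ) Γ)) Δ

end FOID

namespace FOID

/-! ## Syntax: free symbols, substitution, existential closure -/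

section Expressions

variable {L : FirstOrder.Language.{u, v}} {α : Type w}

/-! The proof is a Henkin construction. If the sequent is not provable, then no finite subset of
`Γ`, the definitions `Φ i` and the negations of `Δ` is refutable (`Provable.of_inconsistent`). This
set extends to a maximal consistent set `T` with witnesses, and `T` determines a structure that
satisfies `Γ`, stably satisfies every `Φ i` and falsifies all of `Δ`. Consistency refers to finite
subsets because the rules with eigenvariables need object symbols that are not free in the context,
and `T` as a whole may leave none.

Although all predicates are nullary, rule bodies may contain equality, function symbols and
quantifiers, so a truth assignment is not enough. The language may be so large that there are too
few object symbols to witness every existential formula. However, only finitely many formulas,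
obtained from the rule bodies, require witnesses, and countably many object symbols `e i` can name
all elements. The elements are the indices `i` modulo the equations of `T`; witnesses for `f(x̄) =
y` ensure that the values of terms are named. This gives the truth lemma
`IsTermStructure.holds_iff`. Propositional formulas need no witnesses at all, so `Γ` and `Δ` may be
infinite.

It remains to see that the structure, call it `I`, is a stable model of each definition. By (def R),
`I` is a prefixed point of `C(·, I)` (`IsTermStructure.stepOp_le`). Conversely, every prefixed point
`K` in the same context contains `I` (`IsTermStructure.le_of_stepOp_le`). Suppose a defined `P` is
true in `I` but not in `K`. Since defined predicates are nullary, `K` is described by induction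
hypotheses `F_Q` that are truth constants: `⊤` if `Q` is true in `K`, `⊥` otherwise. In (def L), the
minor premises for true `Q` are axioms. For false `Q`, the body with its positive occurrences
replaced is false in `I`, so its negation is in `T` by the truth lemma. The major premise has `⊥` on
the left. So `T` refutes `P`, a contradiction. Thus `I` is the least prefixed point, and by
monotonicity the least fixpoint. -/

theorem termFree_finite {n : ℕ} (t : L.Term (α ⊕ Fin n)) : (termFree t).Finite := by
  induction t with
  | var a => rcases a with a | i <;> simp [termFree]
  | func f ts ih => exact Set.finite_iUnion ih

theorem Formula.free_finite {D : ℕ → Type x} {fD : ∀ {n : ℕ}, D n → Set α}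
    (hD : ∀ {n : ℕ} (d : D n), (fD d).Finite) {n : ℕ} (φ : Formula L α D n) :
    (φ.free fD).Finite := by
  induction φ with
  | top => exact Set.finite_empty
  | bot => exact Set.finite_empty
  | rel P ts => exact Set.finite_iUnion fun i => termFree_finite (ts i)
  | eq t s => exact (termFree_finite t).union (termFree_finite s)
  | neg φ ih => exact ih
  | and φ ψ ih₁ ih₂ => exact ih₁.union ih₂
  | or φ ψ ih₁ ih₂ => exact ih₁.union ih₂
  | imp φ ψ ih₁ ih₂ => exact ih₁.union ih₂
  | iff φ ψ ih₁ ih₂ => exact ih₁.union ih₂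
  | all φ ih => exact ih
  | ex φ ih => exact ih
  | defn d => exact hD d

theorem FO.free_finite {n : ℕ} (φ : FO L α n) : (FO.free φ).Finite :=
  Formula.free_finite (fun d => d.elim) φ

theorem Definition.free_finite {n : ℕ} (Φ : Definition L α n) : (Definition.free Φ).Finite := by
  refine Set.Finite.biUnion Φ.finite_toSet fun r _ => ?_
  exact (Set.finite_iUnion fun i => termFree_finite (r.args i)).union (FO.free_finite r.body)

theorem IDFormula.free_finite {n : ℕ} (φ : IDFormula L α n) : (IDFormula.free φ).Finite :=
  Formula.free_finite (fun Φ => Definition.free_finite Φ) φ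

/-- Keeps `Γ` and `Δ`, even when infinite, from using up the object symbols needed as witnesses. -/
theorem Formula.IsPropositional.free_eq_empty {D : ℕ → Type x}
    {fD : ∀ {n : ℕ}, D n → Set α} {n : ℕ} {φ : Formula L α D n} (h : φ.IsPropositional) :
    φ.free fD = ∅ := by
  induction φ with
  | top => rfl
  | bot => rfl
  | rel P ts => cases h; simp [Formula.free]
  | eq t s => exact h.elim
  | neg φ ih => exact ih h
  | and φ ψ ih₁ ih₂ => simp [Formula.free, ih₁ h.1, ih₂ h.2]
  | or φ ψ ih₁ ih₂ => simp [Formula.free, ih₁ h.1, ih₂ h.2]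
  | imp φ ψ ih₁ ih₂ => simp [Formula.free, ih₁ h.1, ih₂ h.2]
  | iff φ ψ ih₁ ih₂ => simp [Formula.free, ih₁ h.1, ih₂ h.2]
  | all φ ih => exact h.elim
  | ex φ ih => exact h.elim
  | defn d => exact h.elim

theorem FO.toID_subst {n m : ℕ} (σ : Subst L α n m) (φ : FO L α n) :
    FO.toID (FO.subst σ φ) = IDFormula.subst σ (FO.toID φ) := by
  induction φ generalizing m with
  | top => rfl
  | bot => rfl
  | rel P ts => rfl
  | eq t s => rfl
  | neg φ ih => exact congrArg Formula.neg (ih σ)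
  | and φ ψ ih₁ ih₂ => exact congrArg₂ Formula.and (ih₁ σ) (ih₂ σ)
  | or φ ψ ih₁ ih₂ => exact congrArg₂ Formula.or (ih₁ σ) (ih₂ σ)
  | imp φ ψ ih₁ ih₂ => exact congrArg₂ Formula.imp (ih₁ σ) (ih₂ σ)
  | iff φ ψ ih₁ ih₂ => exact congrArg₂ Formula.iff (ih₁ σ) (ih₂ σ)
  | all φ ih => exact congrArg Formula.all (ih (σ.lift 1))
  | ex φ ih => exact congrArg Formula.ex (ih (σ.lift 1))
  | defn d => exact d.elim

/-! ### Composition of substitutions -/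

theorem term_subst_subst {β γ δ : Type*} (t : L.Term β) (σ : β → L.Term γ) (τ : γ → L.Term δ) :
    (t.subst σ).subst τ = t.subst fun b => (σ b).subst τ := by
  induction t with
  | var b => rfl
  | func f ts ih => simp [FirstOrder.Language.Term.subst, ih]

theorem term_subst_relabel {β γ δ : Type*} (t : L.Term β) (g : β → γ) (τ : γ → L.Term δ) :
    (t.relabel g).subst τ = t.subst fun b => τ (g b) := by
  induction t with
  | var b => rfl
  | func f ts ih => simp [FirstOrder.Language.Term.subst, FirstOrder.Language.Term.relabel, ih]

theorem term_relabel_subst {β γ δ : Type*} (t : L.Term β) (σ : β → L.Term γ) (g : γ → δ) :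
    (t.subst σ).relabel g = t.subst fun b => (σ b).relabel g := by
  induction t with
  | var b => rfl
  | func f ts ih => simp [FirstOrder.Language.Term.subst, FirstOrder.Language.Term.relabel, ih]

theorem term_subst_var {β : Type*} (t : L.Term β) : t.subst FirstOrder.Language.Term.var = t := by
  induction t with
  | var b => rfl
  | func f ts ih => simp [FirstOrder.Language.Term.subst, ih]

/-- Composition of substitutions. -/
def Subst.comp {n m k : ℕ} (σ : Subst L α n m) (τ : Subst L α m k) : Subst L α n k :=
  fun a => (σ a).subst τ

theorem Subst.lift_comp_lift {n m k : ℕ} (σ : Subst L α n m) (τ : Subst L α m k) (l : ℕ) :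
    (σ.lift l).comp (τ.lift l) = (σ.comp τ).lift l := by
  have key : ∀ t : L.Term (α ⊕ Fin m),
      (t.relabel (Sum.map id (Fin.castAdd l))).subst (τ.lift l) =
        (t.subst τ).relabel (Sum.map id (Fin.castAdd l)) := by
    intro t
    rw [term_subst_relabel, term_relabel_subst]
    congr 1
    funext b
    rcases b with b | b <;> simp [Subst.lift]
  funext a
  rcases a with a | i
  · exact key _
  · refine Fin.addCases (fun i => ?_) (fun j => ?_) i
    · simpa [Subst.lift, Subst.comp] using key (σ (Sum.inr i))
    · simp [Subst.lift, Subst.comp, bd, FirstOrder.Language.Term.subst]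

theorem FO.subst_subst {n m k : ℕ} (σ : Subst L α n m) (τ : Subst L α m k) (φ : FO L α n) :
    FO.subst τ (FO.subst σ φ) = FO.subst (σ.comp τ) φ := by
  induction φ generalizing m k with
  | top => rfl
  | bot => rfl
  | rel P ts => exact congrArg (Formula.rel P) (funext fun i => term_subst_subst _ _ _)
  | eq t s => exact congrArg₂ Formula.eq (term_subst_subst _ _ _) (term_subst_subst _ _ _)
  | neg φ ih => exact congrArg Formula.neg (ih σ τ)
  | and φ ψ ih₁ ih₂ => exact congrArg₂ Formula.and (ih₁ σ τ) (ih₂ σ τ)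
  | or φ ψ ih₁ ih₂ => exact congrArg₂ Formula.or (ih₁ σ τ) (ih₂ σ τ)
  | imp φ ψ ih₁ ih₂ => exact congrArg₂ Formula.imp (ih₁ σ τ) (ih₂ σ τ)
  | iff φ ψ ih₁ ih₂ => exact congrArg₂ Formula.iff (ih₁ σ τ) (ih₂ σ τ)
  | all φ ih =>
    exact congrArg Formula.all ((ih (σ.lift 1) (τ.lift 1)).trans (by rw [Subst.lift_comp_lift]; rfl))
  | ex φ ih =>
    exact congrArg Formula.ex ((ih (σ.lift 1) (τ.lift 1)).trans (by rw [Subst.lift_comp_lift]; rfl))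
  | defn d => exact d.elim

/-- The terms `s i` stand at level `0` and contain no bound symbols, so moving them under a binder
and then instantiating it leaves them unchanged. -/
theorem Subst.lift_fill_comp_inst {n : ℕ} (s : Fin n → L.Term (α ⊕ Fin 0))
    (t : L.Term (α ⊕ Fin 0)) :
    ((Subst.fill s).lift 1).comp (Subst.inst (k := 1) fun _ => t) =
      Subst.fill (Fin.snoc s t : Fin (n + 1) → L.Term (α ⊕ Fin 0)) := by
  have key : ∀ t' : L.Term (α ⊕ Fin 0),
      (t'.relabel (Sum.map id (Fin.castAdd 1))).subst (Subst.inst (k := 1) fun _ => t) = t' := by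
    intro t'
    rw [term_subst_relabel]
    conv_rhs => rw [← term_subst_var t']
    congr 1
    funext b
    rcases b with b | b
    · rfl
    · exact b.elim0
  funext a
  rcases a with a | i
  · rfl
  · refine Fin.lastCases ?_ (fun j => ?_) i
    · have : (Fin.last n) = Fin.natAdd n (0 : Fin 1) := rfl
      simp only [Subst.comp, Subst.lift, Subst.fill, Sum.elim_inr, Fin.snoc_last]
      rw [this, Fin.addCases_right]
      rfl
    · have : j.castSucc = Fin.castAdd 1 j := rfl
      simp only [Subst.comp, Subst.lift, Subst.fill, Sum.elim_inr, Fin.snoc_castSucc]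
      rw [this, Fin.addCases_left]
      exact key _

/-- Opening a quantifier under a closing substitution. -/
theorem FO.toID_subst_inst {n : ℕ} (s : Fin n → L.Term (α ⊕ Fin 0)) (t : L.Term (α ⊕ Fin 0))
    (φ : FO L α (n + 1)) :
    IDFormula.subst (Subst.inst (k := 1) fun _ => t)
        (FO.toID (FO.subst ((Subst.fill s).lift 1) φ)) =
      FO.toID (FO.subst (Subst.fill (Fin.snoc s t : Fin (n + 1) → L.Term (α ⊕ Fin 0))) φ) := by
  rw [← FO.toID_subst, FO.subst_subst, Subst.lift_fill_comp_inst]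

/-- The rules for definitions open bodies by `Subst.inst`, the truth lemma closes formulas by
`Subst.fill`; this translates between the two. -/
theorem Subst.inst_eq_fill {k : ℕ} (s : Fin k → L.Term (α ⊕ Fin 0)) :
    (Subst.inst s : Subst L α (0 + k) 0) = Subst.fill (Fin.append Fin.elim0 s) := by
  funext a
  rcases a with a | i
  · rfl
  · refine Fin.addCases (fun i => i.elim0) (fun j => ?_) i
    show Fin.addCases bd s (Fin.natAdd 0 j) = Fin.append Fin.elim0 s (Fin.natAdd 0 j)
    rw [Fin.addCases_right, Fin.append_right]

/-! ### Existential closure -/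

/-- Existential quantification of the `k` innermost bound object symbols. -/
def FO.exs {n : ℕ} : (k : ℕ) → FO L α (n + k) → FO L α n
  | 0, φ => φ
  | k + 1, φ => FO.exs k (.ex φ)

theorem FO.free_exs {n : ℕ} (k : ℕ) (φ : FO L α (n + k)) : FO.free (FO.exs k φ) = FO.free φ := by
  induction k with
  | zero => rfl
  | succ k ih => exact ih (.ex φ)

theorem FO.nullaryPreds_exs {n : ℕ} (k : ℕ) {φ : FO L α (n + k)} (h : φ.NullaryPreds) :
    (FO.exs k φ).NullaryPreds := by
  induction k with
  | zero => exact h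
  | succ k ih => exact ih (φ := .ex φ) h

theorem FO.holds_exs {M : Type*} [L.Structure M] (v : α → M) (I J : PredInt L M) {n : ℕ} (k : ℕ)
    (φ : FO L α (n + k)) (xs : Fin n → M) :
    FO.Holds v I J (FO.exs k φ) xs ↔ ∃ b : Fin k → M, FO.Holds v I J φ (Fin.append xs b) := by
  induction k with
  | zero =>
    refine ⟨fun h => ⟨Fin.elim0, ?_⟩, fun ⟨b, h⟩ => ?_⟩
    · rw [Fin.append_right_nil _ _ rfl]; exact h
    · rw [Fin.append_right_nil _ _ rfl] at h; exact h
  | succ k ih =>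
    refine (ih (.ex φ)).trans ⟨?_, ?_⟩
    · rintro ⟨b, a, h⟩
      refine ⟨(Fin.snoc b a : Fin (k + 1) → M), ?_⟩
      rw [Fin.append_snoc]
      exact h
    · rintro ⟨b, h⟩
      refine ⟨Fin.init b, b (Fin.last k), ?_⟩
      rw [← Fin.snoc_init_self b, Fin.append_snoc] at h
      exact h

/-- Cuts on the formula in which only the innermost symbol has been quantified, since `FO.exs`
quantifies from the inside out. -/
theorem Provable.exsR {Γ Δ : Set (IDFormula L α 0)} {n : ℕ} (k : ℕ) (φ : FO L α (n + k))
    (s : Fin n → L.Term (α ⊕ Fin 0)) (b : Fin k → L.Term (α ⊕ Fin 0)) :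
    Provable (insert (FO.toID (FO.subst (Subst.fill (Fin.append s b)) φ)) Γ)
      (insert (FO.toID (FO.subst (Subst.fill s) (FO.exs k φ))) Δ) := by
  induction k generalizing Γ Δ with
  | zero =>
    refine .ax (.inl ⟨_, Set.mem_insert _ _, ?_⟩)
    rw [Fin.append_right_nil _ _ rfl]
    exact Set.mem_insert _ _
  | succ k ih =>
    refine .cut (FO.toID (FO.subst (Subst.fill (Fin.append s (Fin.init b))) (.ex φ))) ?_ ?_
    · refine Provable.exR (b (Fin.last k)) (.ax (.inl ⟨_, Set.mem_insert _ _, ?_⟩))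
      have := FO.toID_subst_inst (Fin.append s (Fin.init b)) (b (Fin.last k)) φ
      rw [← Fin.append_snoc, Fin.snoc_init_self] at this
      exact this ▸ Set.mem_insert _ _
    · exact ih (.ex φ) (Fin.init b)

/-! ### Replacement of defined predicates by truth values -/

open Classical in
/-- The truth-value formulas that describe the extension `K` of nullary predicates. -/
noncomputable def truthValue (K : Set (PredSym L)) {k : ℕ} (R : L.Relations k) : FO L α k :=
  if (⟨k, R⟩ : PredSym L) ∈ K then .top else .bot

theorem truthValue_of_mem {K : Set (PredSym L)} {k : ℕ} {R : L.Relations k}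
    (h : (⟨k, R⟩ : PredSym L) ∈ K) : (truthValue K R : FO L α k) = .top := if_pos h

theorem truthValue_of_notMem {K : Set (PredSym L)} {k : ℕ} {R : L.Relations k}
    (h : (⟨k, R⟩ : PredSym L) ∉ K) : (truthValue K R : FO L α k) = .bot := if_neg h

theorem free_truthValue (K : Set (PredSym L)) {k : ℕ} (R : L.Relations k) :
    FO.free (truthValue K R : FO L α k) = ∅ := by
  unfold truthValue
  split_ifs <;> rfl

theorem FO.free_replacePos_truthValue (S K : Set (PredSym L)) {n : ℕ} (b : Bool) (ψ : FO L α n) :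
    FO.free (FO.replacePos S (truthValue K) b ψ) ⊆ FO.free ψ := by
  induction ψ generalizing b with
  | top => exact subset_rfl
  | bot => exact subset_rfl
  | rel R ts =>
    unfold FO.replacePos truthValue
    split_ifs
    · exact Set.empty_subset _
    · exact Set.empty_subset _
    · exact subset_rfl
  | eq t s => exact subset_rfl
  | neg φ ih => exact ih (!b)
  | and φ ψ ih₁ ih₂ => exact Set.union_subset_union (ih₁ b) (ih₂ b)
  | or φ ψ ih₁ ih₂ => exact Set.union_subset_union (ih₁ b) (ih₂ b)
  | imp φ ψ ih₁ ih₂ => exact Set.union_subset_union (ih₁ (!b)) (ih₂ b)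
  | iff φ ψ ih₁ ih₂ =>
    exact Set.union_subset (Set.union_subset_union (ih₁ (!b)) (ih₂ b))
      ((Set.union_subset_union (ih₂ (!b)) (ih₁ b)).trans (Set.union_comm _ _).subset)
  | all φ ih => exact ih b
  | ex φ ih => exact ih b
  | defn d => exact d.elim

theorem FO.nullaryPreds_replacePos_truthValue (S K : Set (PredSym L)) {n : ℕ} (b : Bool)
    {ψ : FO L α n} (h : ψ.NullaryPreds) :
    (FO.replacePos S (truthValue K) b ψ).NullaryPreds := by
  induction ψ generalizing b with
  | top => exact h
  | bot => exact h
  | rel R ts =>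
    unfold FO.replacePos truthValue
    split_ifs
    · trivial
    · trivial
    · exact h
  | eq t s => exact h
  | neg φ ih => exact ih (!b) h
  | and φ ψ ih₁ ih₂ => exact ⟨ih₁ b h.1, ih₂ b h.2⟩
  | or φ ψ ih₁ ih₂ => exact ⟨ih₁ b h.1, ih₂ b h.2⟩
  | imp φ ψ ih₁ ih₂ => exact ⟨ih₁ (!b) h.1, ih₂ b h.2⟩
  | iff φ ψ ih₁ ih₂ => exact ⟨⟨ih₁ (!b) h.1, ih₂ b h.2⟩, ⟨ih₂ (!b) h.2, ih₁ b h.1⟩⟩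
  | all φ ih => exact ih b h
  | ex φ ih => exact ih b h
  | defn d => exact d.elim

/-- Replacing the positive occurrences of the symbols in `S` by their truth values in `K` amounts
to interpreting them by `K`. -/
theorem FO.holds_replacePos_truthValue {M : Type*} [L.Structure M] (v : α → M)
    {I K : PredInt L M} {S K' : Set (PredSym L)}
    (hK : ∀ {k : ℕ} (P : L.Relations k) (a : Fin k → M), (⟨k, P⟩ : PredSym L) ∈ S →
      (K k P a ↔ (⟨k, P⟩ : PredSym L) ∈ K'))
    (hS : ∀ {k : ℕ} (P : L.Relations k) (a : Fin k → M), (⟨k, P⟩ : PredSym L) ∉ S →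
      (K k P a ↔ I k P a))
    {n : ℕ} (ψ : FO L α n) (xs : Fin n → M) :
    (FO.Holds v I I (FO.replacePos S (truthValue K') true ψ) xs ↔ FO.Holds v K I ψ xs) ∧
      (FO.Holds v I I (FO.replacePos S (truthValue K') false ψ) xs ↔ FO.Holds v I K ψ xs) := by
  induction ψ with
  | top => exact ⟨Iff.rfl, Iff.rfl⟩
  | bot => exact ⟨Iff.rfl, Iff.rfl⟩
  | rel R ts =>
    refine ⟨?_, ?_⟩
    · by_cases h : (⟨_, R⟩ : PredSym L) ∈ S
      · by_cases h' : (⟨_, R⟩ : PredSym L) ∈ K'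
        · simp only [FO.replacePos, h, truthValue_of_mem h', and_self, if_true]
          exact iff_of_true trivial ((hK R _ h).2 h')
        · simp only [FO.replacePos, h, truthValue_of_notMem h', and_self, if_true]
          exact iff_of_false id (mt (hK R _ h).1 h')
      · simp only [FO.replacePos, h, and_false, if_false]
        exact (hS R _ h).symm
    · simp only [FO.replacePos, Bool.false_eq_true, false_and, if_false]
      exact Iff.rfl
  | eq t s => exact ⟨Iff.rfl, Iff.rfl⟩
  | neg φ ih => exact ⟨not_congr (ih xs).2, not_congr (ih xs).1⟩
  | and φ ψ ih₁ ih₂ =>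
    exact ⟨and_congr (ih₁ xs).1 (ih₂ xs).1, and_congr (ih₁ xs).2 (ih₂ xs).2⟩
  | or φ ψ ih₁ ih₂ =>
    exact ⟨or_congr (ih₁ xs).1 (ih₂ xs).1, or_congr (ih₁ xs).2 (ih₂ xs).2⟩
  | imp φ ψ ih₁ ih₂ =>
    exact ⟨imp_congr (ih₁ xs).2 (ih₂ xs).1, imp_congr (ih₁ xs).1 (ih₂ xs).2⟩
  | iff φ ψ ih₁ ih₂ =>
    exact ⟨and_congr (imp_congr (ih₁ xs).2 (ih₂ xs).1) (imp_congr (ih₂ xs).2 (ih₁ xs).1),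
      and_congr (imp_congr (ih₁ xs).1 (ih₂ xs).2) (imp_congr (ih₂ xs).1 (ih₁ xs).2)⟩
  | all φ ih => exact ⟨forall_congr' fun a => (ih _).1, forall_congr' fun a => (ih _).2⟩
  | ex φ ih => exact ⟨exists_congr fun a => (ih _).1, exists_congr fun a => (ih _).2⟩
  | defn d => exact d.elim

/-- The two interpretations exchange roles under negation, so monotonicity in the first and
antitonicity in the second must be proved together. -/
theorem FO.Holds.mono {M : Type*} [L.Structure M] {v : α → M} {n : ℕ} {I I' J J' : PredInt L M}
    (hI : I ≤ I') (hJ : J' ≤ J) {ψ : FO L α n} {xs : Fin n → M} (h : FO.Holds v I J ψ xs) :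
    FO.Holds v I' J' ψ xs := by
  induction ψ generalizing I I' J J' with
  | top => exact h
  | bot => exact h
  | rel R ts => exact hI _ _ _ h
  | eq t s => exact h
  | neg φ ih => exact fun h' => h (ih hJ hI h')
  | and φ ψ ih₁ ih₂ => exact ⟨ih₁ hI hJ h.1, ih₂ hI hJ h.2⟩
  | or φ ψ ih₁ ih₂ => exact h.imp (ih₁ hI hJ) (ih₂ hI hJ)
  | imp φ ψ ih₁ ih₂ => exact fun h' => ih₂ hI hJ (h (ih₁ hJ hI h'))
  | iff φ ψ ih₁ ih₂ =>
    exact ⟨fun h' => ih₂ hI hJ (h.1 (ih₁ hJ hI h')), fun h' => ih₁ hI hJ (h.2 (ih₂ hJ hI h'))⟩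
  | all φ ih => exact fun a => ih hI hJ (h a)
  | ex φ ih => exact h.imp fun a => ih hI hJ
  | defn d => exact d.elim

end Expressions

/-! ## Maximal consistent sets -/

section Consistency

variable {L : FirstOrder.Language.{u, v}} {α : Type w}

theorem Provable.id {Γ Δ : Set (IDFormula L α 0)} (φ : IDFormula L α 0) (h : φ ∈ Γ) (h' : φ ∈ Δ) :
    Provable Γ Δ := .ax (.inl ⟨φ, h, h'⟩)

theorem Provable.swapL {Γ Δ : Set (IDFormula L α 0)} {φ ψ : IDFormula L α 0}
    (h : Provable (insert φ (insert ψ Γ)) Δ) : Provable (insert ψ (insert φ Γ)) Δ :=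
  Set.insert_comm φ ψ Γ ▸ h

/-- Some finite subset of `T` is refutable. -/
def Inconsistent (T : Set (IDFormula L α 0)) : Prop :=
  ∃ T₀ ⊆ T, T₀.Finite ∧ Provable T₀ ∅

theorem Inconsistent.cut {T : Set (IDFormula L α 0)} {φ : IDFormula L α 0}
    {T₀ : Set (IDFormula L α 0)} (hT₀ : T₀ ⊆ T) (hfin : T₀.Finite) (h : Provable T₀ (insert φ ∅))
    (hφ : Inconsistent (insert φ T)) : Inconsistent T := by
  obtain ⟨T₁, hT₁, hfin₁, h₁⟩ := hφ
  refine ⟨T₀ ∪ T₁ \ {φ}, Set.union_subset hT₀ fun ψ hψ => (hT₁ hψ.1).resolve_left hψ.2,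
    hfin.union (hfin₁.subset Set.sdiff_subset), .cut φ ?_ ?_⟩
  · exact .wk Set.subset_union_left (by simp) h
  · refine .wk (fun ψ hψ => ?_) subset_rfl h₁
    by_cases h' : ψ = φ
    · exact .inl h'
    · exact .inr (.inr ⟨hψ, h'⟩)

/-- Maximal consistent sets of FO(ID)-formulas. -/
structure MaximalConsistent (T : Set (IDFormula L α 0)) : Prop where
  consistent : ¬ Inconsistent T
  maximal : ∀ φ ∉ T, Inconsistent (insert φ T)

/-- Zorn's lemma applies because a refutation uses a finite set, which lies in a single member of a
chain. -/
theorem exists_maximalConsistent {T : Set (IDFormula L α 0)} (hT : ¬ Inconsistent T) :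
    ∃ T', T ⊆ T' ∧ MaximalConsistent T' := by
  obtain ⟨T', hTT', hmax⟩ := zorn_subset_nonempty {U : Set (IDFormula L α 0) | ¬ Inconsistent U}
    (fun c hc hchain hne => ⟨⋃₀ c, fun ⟨T₀, hT₀, hfin, h⟩ => by
      obtain ⟨U, hU, hsub⟩ :=
        DirectedOn.exists_mem_subset_of_finite_of_subset_sUnion hne hchain.directedOn hfin hT₀
      exact hc hU ⟨T₀, hsub, hfin, h⟩, fun s hs => Set.subset_sUnion_of_mem hs⟩) T hT
  refine ⟨T', hTT', hmax.1, fun φ hφ => ?_⟩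
  by_contra hcon
  exact hφ (hmax.2 hcon (Set.subset_insert φ T') (Set.mem_insert φ T'))

/-! ### Connectives and quantifiers in maximal consistent sets -/

namespace MaximalConsistent

variable {T : Set (IDFormula L α 0)}

theorem mem_of_provable (hT : MaximalConsistent T) {φ : IDFormula L α 0}
    {T₀ : Set (IDFormula L α 0)} (hT₀ : T₀ ⊆ T) (hfin : T₀.Finite) (h : Provable T₀ (insert φ ∅)) :
    φ ∈ T := by
  by_contra hφ
  exact hT.consistent (Inconsistent.cut hT₀ hfin h (hT.maximal φ hφ))

theorem notMem_of_provable (hT : MaximalConsistent T) {φ : IDFormula L α 0}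
    {T₀ : Set (IDFormula L α 0)} (hT₀ : T₀ ⊆ T) (hfin : T₀.Finite)
    (h : Provable (insert φ T₀) ∅) : φ ∉ T := fun hφ =>
  hT.consistent ⟨insert φ T₀, Set.insert_subset hφ hT₀, hfin.insert φ, h⟩

theorem mem_of_mem (hT : MaximalConsistent T) {φ ψ : IDFormula L α 0} (hφ : φ ∈ T)
    (h : Provable (insert φ ∅) (insert ψ ∅)) : ψ ∈ T :=
  hT.mem_of_provable (Set.insert_subset hφ (Set.empty_subset T)) (Set.toFinite _) h

theorem mem_of_mem_of_mem (hT : MaximalConsistent T) {φ χ ψ : IDFormula L α 0} (hφ : φ ∈ T)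
    (hχ : χ ∈ T) (h : Provable (insert φ (insert χ ∅)) (insert ψ ∅)) : ψ ∈ T :=
  hT.mem_of_provable (Set.insert_subset hφ (Set.insert_subset hχ (Set.empty_subset T)))
    (Set.toFinite _) h

theorem top_mem (hT : MaximalConsistent T) : Formula.top ∈ T :=
  hT.mem_of_provable (Set.empty_subset T) Set.finite_empty (.ax (.inr (.inr (Set.mem_insert _ _))))

theorem bot_notMem (hT : MaximalConsistent T) : Formula.bot ∉ T :=
  hT.notMem_of_provable (Set.empty_subset T) Set.finite_empty
    (.ax (.inr (.inl (Set.mem_insert _ _))))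

theorem neg_mem_iff (hT : MaximalConsistent T) {φ : IDFormula L α 0} :
    Formula.neg φ ∈ T ↔ φ ∉ T := by
  constructor
  · intro h
    exact hT.notMem_of_provable (Set.insert_subset h (Set.empty_subset T)) (Set.toFinite _)
      (.swapL
        (.negL (.ax (.inl ⟨φ, Set.mem_insert _ _, Set.mem_insert _ _⟩))))
  · intro h
    obtain ⟨T₁, hT₁, hfin₁, h₁⟩ := hT.maximal φ h
    refine hT.mem_of_provable (T₀ := T₁ \ {φ}) (fun ψ hψ => (hT₁ hψ.1).resolve_left hψ.2)
      (hfin₁.subset Set.sdiff_subset) ?_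
    refine .negR (.wk (fun ψ hψ => ?_) subset_rfl h₁)
    by_cases h' : ψ = φ
    · exact .inl h'
    · exact .inr ⟨hψ, h'⟩

theorem and_mem_iff (hT : MaximalConsistent T) {φ ψ : IDFormula L α 0} :
    Formula.and φ ψ ∈ T ↔ φ ∈ T ∧ ψ ∈ T := by
  refine ⟨fun h => ⟨hT.mem_of_mem h ?_, hT.mem_of_mem h ?_⟩,
    fun h => hT.mem_of_mem_of_mem h.1 h.2 ?_⟩
  · exact .andL (.id φ (by simp) (by simp))
  · exact .andL (.id ψ (by simp) (by simp))
  · exact .andR (.id φ (by simp) (by simp)) (.id ψ (by simp) (by simp))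

theorem or_mem_iff (hT : MaximalConsistent T) {φ ψ : IDFormula L α 0} :
    Formula.or φ ψ ∈ T ↔ φ ∈ T ∨ ψ ∈ T := by
  refine ⟨fun h => ?_, fun h => ?_⟩
  · by_contra! hcon
    have h₁ := hT.neg_mem_iff.2 hcon.1
    refine hcon.2 (hT.mem_of_mem_of_mem h h₁ ?_)
    refine .orL (.swapL
      (.negL (.id φ (by simp) (by simp)))) (.id ψ (by simp) (by simp))
  · refine h.elim (fun h => hT.mem_of_mem h ?_) (fun h => hT.mem_of_mem h ?_)
    · exact .orR (.id φ (by simp) (by simp))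
    · exact .orR (.id ψ (by simp) (by simp))

theorem imp_mem_iff (hT : MaximalConsistent T) {φ ψ : IDFormula L α 0} :
    Formula.imp φ ψ ∈ T ↔ (φ ∈ T → ψ ∈ T) := by
  refine ⟨fun h h' => hT.mem_of_mem_of_mem h h' ?_, fun h => ?_⟩
  · exact .impL (.id φ (by simp) (by simp)) (.id ψ (by simp) (by simp))
  · by_cases hφ : φ ∈ T
    · exact hT.mem_of_mem (h hφ) (.impR (.id ψ (by simp) (by simp)))
    · refine hT.mem_of_mem (hT.neg_mem_iff.2 hφ) (.impR ?_)
      exact .swapL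
        (.negL (.id φ (by simp) (by simp)))

theorem iff_mem_iff (hT : MaximalConsistent T) {φ ψ : IDFormula L α 0} :
    Formula.iff φ ψ ∈ T ↔ ((φ ∈ T → ψ ∈ T) ∧ (ψ ∈ T → φ ∈ T)) := by
  rw [← hT.imp_mem_iff, ← hT.imp_mem_iff]
  refine ⟨fun h => ⟨hT.mem_of_mem h ?_, hT.mem_of_mem h ?_⟩,
    fun h => hT.mem_of_mem_of_mem h.1 h.2 ?_⟩
  · exact .impR (.swapL (.iffL (Γ := insert φ ∅)
      (.id φ (by simp) (by simp)) (.id ψ (by simp) (by simp))))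
  · exact .impR (.swapL (.iffL (Γ := insert ψ ∅)
      (.id ψ (by simp) (by simp)) (.id φ (by simp) (by simp))))
  · refine .iffR ?_ ?_
    · refine .swapL (.impL ?_ ?_)
      · exact .id φ (by simp) (by simp)
      · exact .id ψ (by simp) (by simp)
    · refine .wk (Γ' := insert (.imp ψ φ) (insert ψ (insert (.imp φ ψ) ∅))) ?_ subset_rfl (.impL ?_ ?_)
      · intro χ hχ
        simp only [Set.mem_insert_iff] at hχ ⊢
        tauto
      · exact .id ψ (by simp) (by simp)
      · exact .id φ (by simp) (by simp)

theorem ex_mem_of_inst (hT : MaximalConsistent T) {φ : IDFormula L α 1} (t : L.Term (α ⊕ Fin 0))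
    (h : IDFormula.subst (Subst.inst (k := 1) fun _ => t) φ ∈ T) : Formula.ex φ ∈ T :=
  hT.mem_of_mem h (.exR t (.id _ (Set.mem_insert _ _) (Set.mem_insert _ _)))

theorem inst_mem_of_all (hT : MaximalConsistent T) {φ : IDFormula L α 1} (t : L.Term (α ⊕ Fin 0))
    (h : Formula.all φ ∈ T) : IDFormula.subst (Subst.inst (k := 1) fun _ => t) φ ∈ T :=
  hT.mem_of_mem h (.allL t (.id _ (Set.mem_insert _ _) (Set.mem_insert _ _)))

theorem ex_neg_mem_of_all_notMem [Infinite α] (hT : MaximalConsistent T) {φ : IDFormula L α 1}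
    (h : Formula.all φ ∉ T) : Formula.ex (Formula.neg φ) ∈ T := by
  by_contra hcon
  refine h (hT.mem_of_mem (hT.neg_mem_iff.2 hcon) ?_)
  -- The derivation has only `¬∃¬φ` as context, so a symbol not free in `φ` satisfies the
  -- eigenvariable condition, whatever is free in `T`.
  obtain ⟨x, hx⟩ := (IDFormula.free_finite φ).exists_notMem
  refine .allR x ?_ ?_
  · have : IDFormula.free (Formula.neg (Formula.ex (Formula.neg φ))) = IDFormula.free φ := rfl
    simp [freeSet, this, hx]
  · refine .negL (.exR (obj x) ?_)
    exact .negR (.id _ (Set.mem_insert _ _) (Set.mem_insert _ _))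

end MaximalConsistent

/-! ### Equality -/

theorem term_subst_congr {n : ℕ} {β : Type*} (t : L.Term (α ⊕ Fin n))
    {σ τ : α ⊕ Fin n → L.Term β} (h : ∀ a ∈ termFree t, σ (Sum.inl a) = τ (Sum.inl a))
    (h' : ∀ i, σ (Sum.inr i) = τ (Sum.inr i)) : t.subst σ = t.subst τ := by
  induction t with
  | var a =>
    rcases a with a | i
    · exact h a rfl
    · exact h' i
  | func f ts ih =>
    simp only [FirstOrder.Language.Term.subst]
    congr 1
    funext i
    exact ih i fun a ha => h a (Set.mem_iUnion.2 ⟨i, ha⟩)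

theorem term_subst_ofObj_eq_self (t : L.Term (α ⊕ Fin 0)) {τ : α → L.Term (α ⊕ Fin 0)}
    (h : ∀ a ∈ termFree t, τ a = obj a) : t.subst (Subst.ofObj τ) = t := by
  conv_rhs => rw [← term_subst_var t]
  exact term_subst_congr t h fun i => i.elim0

open Classical in
theorem single_of_ne {x c : α} (h : c ≠ x) (t : L.Term (α ⊕ Fin 0)) : single x t c = obj c :=
  Function.update_of_ne h _ _

open Classical in
theorem double_of_ne {y c : α} (h : c ≠ y) (x : α) (s t : L.Term (α ⊕ Fin 0)) :
    double x s y t c = single x s c :=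
  Function.update_of_ne h _ _

/-- Replacement of equals in an equation. -/
theorem Provable.eq_replace [Infinite α] (p q t s : L.Term (α ⊕ Fin 0)) (x : α)
    (hxp : x ∉ termFree (p.subst (Subst.ofObj (single x s))))
    (hxq : x ∉ termFree (q.subst (Subst.ofObj (single x s)))) :
    Provable (insert (.eq t s) (insert (.eq (p.subst (Subst.ofObj (single x t)))
      (q.subst (Subst.ofObj (single x t)))) ∅))
      (insert (.eq (p.subst (Subst.ofObj (single x s))) (q.subst (Subst.ofObj (single x s)))) ∅) := by
  set p' := p.subst (Subst.ofObj (single x s)) with hp'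
  set q' := q.subst (Subst.ofObj (single x s)) with hq'
  -- The equality rule exchanges two terms at two symbols. A fresh `y` makes the second slot
  -- vacuous, and since `x` is not free in `p'`, `q'`, the right side is not affected; the premise
  -- becomes an axiom.
  obtain ⟨y, hy⟩ := ((((termFree_finite p).union (termFree_finite q)).union
    ((termFree_finite p').union (termFree_finite q'))).insert x).exists_notMem
  simp only [Set.mem_insert_iff, Set.mem_union, not_or] at hy
  obtain ⟨hyx, ⟨hyp, hyq⟩, hyp', hyq'⟩ := hy
  have key₁ : ∀ (r a b : L.Term (α ⊕ Fin 0)), y ∉ termFree r →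
      r.subst (Subst.ofObj (double x a y b)) = r.subst (Subst.ofObj (single x a)) := by
    intro r a b hr
    refine term_subst_congr r (fun c hc => ?_) fun i => i.elim0
    have : c ≠ y := fun h => hr (h ▸ hc)
    exact double_of_ne this x a b
  have key₂ : ∀ (r a b : L.Term (α ⊕ Fin 0)), x ∉ termFree r → y ∉ termFree r →
      r.subst (Subst.ofObj (double x a y b)) = r := by
    intro r a b hr hr'
    refine term_subst_ofObj_eq_self r fun c hc => ?_
    have h₁ : c ≠ x := fun h => hr (h ▸ hc)
    have h₂ : c ≠ y := fun h => hr' (h ▸ hc)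
    rw [double_of_ne h₂, single_of_ne h₁]
  have h := Provable.eqL (Γ := insert (.eq p q) ∅) (Δ := insert (.eq p' q') ∅) (Ne.symm hyx) t s
    (.ax (.inl ⟨.eq p' q', by
      simp [substSet, IDFormula.subst, Formula.subst, key₁ p s t hyp, key₁ q s t hyq, hp', hq'],
      by simp [substSet, IDFormula.subst, Formula.subst, key₂ p' s t hxp hyp',
        key₂ q' s t hxq hyq']⟩))
  simpa [substSet, IDFormula.subst, Formula.subst, key₁ p t s hyp, key₁ q t s hyq,
    key₂ p' t s hxp hyp', key₂ q' t s hxq hyq'] using h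

namespace MaximalConsistent

variable {T : Set (IDFormula L α 0)}

theorem eq_refl_mem (hT : MaximalConsistent T) (t : L.Term (α ⊕ Fin 0)) : Formula.eq t t ∈ T :=
  hT.mem_of_provable (Set.empty_subset T) Set.finite_empty (.eqR t)

theorem subst_single_self (x : α) (t : L.Term (α ⊕ Fin 0)) :
    (obj x : L.Term (α ⊕ Fin 0)).subst (Subst.ofObj (single x t)) = t := by
  simp [obj, FirstOrder.Language.Term.subst, Subst.ofObj, single]

theorem subst_single_of_notMem {x : α} {r : L.Term (α ⊕ Fin 0)} (hx : x ∉ termFree r)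
    (t : L.Term (α ⊕ Fin 0)) : r.subst (Subst.ofObj (single x t)) = r :=
  term_subst_ofObj_eq_self r fun c hc => by
    have h : c ≠ x := fun h => hx (h ▸ hc)
    exact single_of_ne h t

theorem eq_symm_mem [Infinite α] (hT : MaximalConsistent T) {t s : L.Term (α ⊕ Fin 0)}
    (h : Formula.eq t s ∈ T) : Formula.eq s t ∈ T := by
  obtain ⟨x, hx⟩ := ((termFree_finite t).union (termFree_finite s)).exists_notMem
  simp only [Set.mem_union, not_or] at hx
  -- Replaces `t` by `s` on the left side of `t = t`.
  have := Provable.eq_replace (obj x) t t s x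
    (by rw [subst_single_self]; exact hx.2) (by rw [subst_single_of_notMem hx.1]; exact hx.1)
  rw [subst_single_self, subst_single_self, subst_single_of_notMem hx.1,
    subst_single_of_notMem hx.1] at this
  exact hT.mem_of_mem_of_mem h (hT.eq_refl_mem t) this

theorem eq_trans_mem [Infinite α] (hT : MaximalConsistent T) {t s r : L.Term (α ⊕ Fin 0)}
    (h : Formula.eq t s ∈ T) (h' : Formula.eq s r ∈ T) : Formula.eq t r ∈ T := by
  obtain ⟨x, hx⟩ := ((termFree_finite t).union (termFree_finite r)).exists_notMem
  simp only [Set.mem_union, not_or] at hx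
  -- Replaces `s` by `r` on the right side of `t = s`.
  have := Provable.eq_replace t (obj x) s r x
    (by rw [subst_single_of_notMem hx.1]; exact hx.1) (by rw [subst_single_self]; exact hx.2)
  rw [subst_single_self, subst_single_self, subst_single_of_notMem hx.1,
    subst_single_of_notMem hx.1] at this
  exact hT.mem_of_mem_of_mem h' h this

theorem eq_func_update_mem [Infinite α] (hT : MaximalConsistent T) {k : ℕ} (f : L.Functions k)
    (ts : Fin k → L.Term (α ⊕ Fin 0)) (i : Fin k) {s : L.Term (α ⊕ Fin 0)}
    (h : Formula.eq (ts i) s ∈ T) :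
    Formula.eq (.func f ts) (.func f (Function.update ts i s)) ∈ T := by
  obtain ⟨x, hx⟩ := ((termFree_finite (.func f ts)).union (termFree_finite s)).exists_notMem
  simp only [Set.mem_union, not_or] at hx
  have hxi : ∀ j, x ∉ termFree (ts j) := fun j hj => hx.1 (Set.mem_iUnion.2 ⟨j, hj⟩)
  have key : ∀ r : L.Term (α ⊕ Fin 0),
      (FirstOrder.Language.Term.func f (Function.update ts i (obj x))).subst
        (Subst.ofObj (single x r)) = .func f (Function.update ts i r) := by
    intro r
    simp only [FirstOrder.Language.Term.subst]
    congr 1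
    funext j
    by_cases hj : j = i
    · subst hj
      simp [subst_single_self]
    · simp [Function.update_of_ne hj, subst_single_of_notMem (hxi j)]
  have := Provable.eq_replace (.func f ts) (.func f (Function.update ts i (obj x))) (ts i) s x
    (by rw [subst_single_of_notMem hx.1]; exact hx.1) (by
      rw [key]
      simp only [termFree, Set.mem_iUnion, not_exists]
      intro j
      by_cases hj : j = i
      · subst hj
        simpa using hx.2
      · simpa [Function.update_of_ne hj] using hxi j)
  rw [key, key, Function.update_eq_self, subst_single_of_notMem hx.1,
    subst_single_of_notMem hx.1] at this
  exact hT.mem_of_mem_of_mem h (hT.eq_refl_mem _) this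

theorem eq_func_mem [Infinite α] (hT : MaximalConsistent T) {k : ℕ} (f : L.Functions k)
    {ts ss : Fin k → L.Term (α ⊕ Fin 0)} (h : ∀ i, Formula.eq (ts i) (ss i) ∈ T) :
    Formula.eq (.func f ts) (.func f ss) ∈ T := by
  classical
  -- The arguments are replaced one at a time; `U` is the set of positions already treated.
  suffices H : ∀ U : Finset (Fin k), Formula.eq (.func f ts) (.func f (U.piecewise ss ts)) ∈ T by
    simpa using H Finset.univ
  intro U
  induction U using Finset.induction_on with
  | empty => simpa using hT.eq_refl_mem _
  | insert i U hi ih =>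
    rw [Finset.piecewise_insert]
    refine hT.eq_trans_mem ih (hT.eq_func_update_mem f _ i ?_)
    simpa [hi] using h i

end MaximalConsistent

end Consistency

/-! ## Henkin extensions -/

section Henkin

variable {L : FirstOrder.Language.{u, v}} {α : Type w}

/-- If `T₀` refutes `∃x φ → φ(c)`, then classically `T₀` proves `∃x φ` and refutes `φ(c)`. As `c` is
fresh, `T₀` then also refutes `∃x φ`, and a cut refutes `T₀`. -/
theorem not_inconsistent_insert_henkin {T : Set (IDFormula L α 0)} (hT : ¬ Inconsistent T)
    {φ : IDFormula L α 1} {c : α} (hc : c ∉ freeSet T) (hcφ : c ∉ IDFormula.free φ) :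
    ¬ Inconsistent (insert (.imp (.ex φ)
      (IDFormula.subst (Subst.inst (k := 1) fun _ => obj c) φ)) T) := by
  set θ := IDFormula.subst (Subst.inst (k := 1) fun _ => obj c) φ with hθ
  rintro ⟨T₁, hT₁, hfin₁, h₁⟩
  set T₀ := T₁ \ {.imp (.ex φ) θ} with hT₀
  have hsub : T₀ ⊆ T := fun ψ hψ => (hT₁ hψ.1).resolve_left hψ.2
  have h : Provable (insert (.imp (.ex φ) θ) T₀) ∅ := by
    refine .wk (fun ψ hψ => ?_) subset_rfl h₁
    by_cases h' : ψ = .imp (.ex φ) θ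
    · exact .inl h'
    · exact .inr ⟨hψ, h'⟩
  have hex : Provable T₀ (insert (.ex φ) ∅) := by
    refine .cut (.imp (.ex φ) θ) (.impR ?_) (.wk subset_rfl (Set.empty_subset _) h)
    exact .id (.ex φ) (by simp) (by simp)
  have hinst : Provable (insert θ T₀) ∅ := by
    refine .cut (.imp (.ex φ) θ) (.impR ?_)
      (.wk (Set.insert_subset_insert (Set.subset_insert _ _)) subset_rfl h)
    exact .id θ (by simp) (by simp)
  refine hT ⟨T₀, hsub, hfin₁.subset Set.sdiff_subset, .cut (.ex φ) hex (.exL c ?_ hinst)⟩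
  have : c ∉ freeSet T₀ := fun h => hc (Set.biUnion_subset_biUnion_left hsub h)
  simpa [freeSet, hcφ] using this

theorem freeSet_insert (φ : IDFormula L α 0) (T : Set (IDFormula L α 0)) :
    freeSet (insert φ T) = IDFormula.free φ ∪ freeSet T :=
  Set.biUnion_insert _ _ _

/-- Every consistent set with finitely many free object symbols extends to a maximal consistent
set with witnesses in a given infinite set for countably many existential formulas. -/
theorem exists_maximalConsistent_henkin {T : Set (IDFormula L α 0)} (hT : ¬ Inconsistent T)
    (hfin : (freeSet T).Finite) {A : Set α} (hA : A.Infinite) (w : ℕ → IDFormula L α 1) :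
    ∃ T', T ⊆ T' ∧ MaximalConsistent T' ∧ ∀ k, Formula.ex (w k) ∈ T' →
      ∃ c ∈ A, IDFormula.subst (Subst.inst (k := 1) fun _ => obj c) (w k) ∈ T' := by
  -- Each stage adds one Henkin implication, so the free symbols remain finite in number and `A`
  -- always has an unused one. Maximality is imposed only on the union of the stages.
  let State := {U : Set (IDFormula L α 0) // ¬ Inconsistent U ∧ (freeSet U).Finite}
  have step : ∀ (U : State) (φ : IDFormula L α 1), ∃ U' : State, U.1 ⊆ U'.1 ∧ ∃ c ∈ A,
      Formula.imp (.ex φ) (IDFormula.subst (Subst.inst (k := 1) fun _ => obj c) φ) ∈ U'.1 := by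
    rintro ⟨U, hU, hUfin⟩ φ
    obtain ⟨c, hcA, hc⟩ := hA.exists_notMem_finite (hUfin.union (IDFormula.free_finite φ))
    simp only [Set.mem_union, not_or] at hc
    refine ⟨⟨_, not_inconsistent_insert_henkin hU hc.1 hc.2, ?_⟩, Set.subset_insert _ _, c, hcA,
      Set.mem_insert _ _⟩
    rw [freeSet_insert]
    exact (IDFormula.free_finite _).union hUfin
  choose next hsub hwit using step
  let seq : ℕ → State := fun k => Nat.rec ⟨T, hT, hfin⟩ (fun k U => next U (w k)) k
  have hmono : Monotone fun k => (seq k).1 := monotone_nat_of_le_succ fun k => hsub (seq k) (w k)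
  have hunion : ¬ Inconsistent (⋃ k, (seq k).1) := by
    rintro ⟨T₀, hT₀, hfin₀, h⟩
    rw [← Set.sUnion_range] at hT₀
    obtain ⟨_, ⟨k, rfl⟩, hk⟩ := DirectedOn.exists_mem_subset_of_finite_of_subset_sUnion
      (Set.range_nonempty _) (hmono.directed_le.directedOn_range) hfin₀ hT₀
    exact (seq k).2.1 ⟨T₀, hk, hfin₀, h⟩
  obtain ⟨T', hTT', hmax⟩ := exists_maximalConsistent hunion
  refine ⟨T', (Set.subset_iUnion (fun k => (seq k).1) 0).trans hTT', hmax, fun k hk => ?_⟩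
  obtain ⟨c, hcA, hc⟩ := hwit (seq k) (w k)
  exact ⟨c, hcA, hmax.imp_mem_iff.1
    (hTT' (Set.mem_iUnion.2 ⟨k + 1, hc⟩)) hk⟩

/-! ### The formulas that need witnesses -/

/-- The formulas `f(x̄) = y` for the function symbols `f` of a term. -/
def termWitnesses {n : ℕ} : L.Term (α ⊕ Fin n) → Set (Σ k, FO L α (k + 1))
  | .var _ => ∅
  | .func (l := k) f ts =>
      insert ⟨k, .eq (.func f fun i => bd i.castSucc) (bd (Fin.last k))⟩
        (⋃ i, termWitnesses (ts i))

/-- The formulas for which a term structure needs witnesses in order to evaluate a formula. -/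
def FO.witnesses : {n : ℕ} → FO L α n → Set (Σ k, FO L α (k + 1))
  | _, .top => ∅
  | _, .bot => ∅
  | _, .rel _ _ => ∅
  | _, .eq t s => termWitnesses t ∪ termWitnesses s
  | _, .neg φ => FO.witnesses φ
  | _, .and φ ψ => FO.witnesses φ ∪ FO.witnesses ψ
  | _, .or φ ψ => FO.witnesses φ ∪ FO.witnesses ψ
  | _, .imp φ ψ => FO.witnesses φ ∪ FO.witnesses ψ
  | _, .iff φ ψ => FO.witnesses φ ∪ FO.witnesses ψ
  | n, .all φ => insert ⟨n, .neg φ⟩ (FO.witnesses φ)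
  | n, .ex φ => insert ⟨n, φ⟩ (FO.witnesses φ)
  | _, .defn d => d.elim

theorem termWitnesses_finite {n : ℕ} (t : L.Term (α ⊕ Fin n)) : (termWitnesses t).Finite := by
  induction t with
  | var a => exact Set.finite_empty
  | func f ts ih => exact (Set.finite_iUnion ih).insert _

theorem FO.witnesses_finite {n : ℕ} (φ : FO L α n) : (FO.witnesses φ).Finite := by
  induction φ with
  | top => exact Set.finite_empty
  | bot => exact Set.finite_empty
  | rel P ts => exact Set.finite_empty
  | eq t s => exact (termWitnesses_finite t).union (termWitnesses_finite s)
  | neg φ ih => exact ih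
  | and φ ψ ih₁ ih₂ => exact ih₁.union ih₂
  | or φ ψ ih₁ ih₂ => exact ih₁.union ih₂
  | imp φ ψ ih₁ ih₂ => exact ih₁.union ih₂
  | iff φ ψ ih₁ ih₂ => exact ih₁.union ih₂
  | all φ ih => exact ih.insert _
  | ex φ ih => exact ih.insert _
  | defn d => exact d.elim

/-- `T` has witnesses, among the object symbols `e i`, for the formulas in `X`. -/
def HasWitnesses (T : Set (IDFormula L α 0)) (e : ℕ → α) (X : Set (Σ k, FO L α (k + 1))) : Prop :=
  ∀ q ∈ X, ∀ σ : Fin q.1 → ℕ,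
    FO.toID (FO.subst (Subst.fill fun i => obj (e (σ i))) (.ex q.2)) ∈ T →
      ∃ j, FO.toID (FO.subst (Subst.fill fun i =>
        obj (e ((Fin.snoc σ j : Fin (q.1 + 1) → ℕ) i))) q.2) ∈ T

theorem snoc_comp {β γ : Type*} (g : β → γ) {n : ℕ} (σ : Fin n → β) (j : β) :
    (Fin.snoc (fun i => g (σ i)) (g j) : Fin (n + 1) → γ) =
      fun i => g ((Fin.snoc σ j : Fin (n + 1) → β) i) :=
  (Fin.comp_snoc g σ j).symm

theorem exists_hasWitnesses {T : Set (IDFormula L α 0)} (hT : ¬ Inconsistent T)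
    (hfin : (freeSet T).Finite) {e : ℕ → α} (he : (Set.range e).Infinite)
    {X : Set (Σ k, FO L α (k + 1))} (hX : X.Countable) :
    ∃ T', T ⊆ T' ∧ MaximalConsistent T' ∧ HasWitnesses T' e X := by
  -- The formula `⊤` only makes the set non-empty, so that a sequence can enumerate it.
  let W : Set (IDFormula L α 1) := insert .top (Set.range fun p : Σ q : X, (Fin q.1.1 → ℕ) =>
    FO.toID (FO.subst ((Subst.fill fun i => obj (e (p.2 i))).lift 1) p.1.1.2))
  have hW : W.Countable := by
    have : Countable X := hX.to_subtype
    exact (Set.countable_range _).insert _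
  obtain ⟨w, hw⟩ := hW.exists_eq_range (Set.insert_nonempty _ _)
  obtain ⟨T', hTT', hmax, hwit⟩ := exists_maximalConsistent_henkin hT hfin he w
  refine ⟨T', hTT', hmax, fun q hq σ hex => ?_⟩
  obtain ⟨k, hk⟩ : FO.toID (FO.subst ((Subst.fill fun i => obj (e (σ i))).lift 1) q.2) ∈
      Set.range w := hw ▸ Set.mem_insert_of_mem _ ⟨⟨⟨q, hq⟩, σ⟩, rfl⟩
  obtain ⟨_, ⟨j, rfl⟩, hj⟩ := hwit k (hk ▸ hex)
  refine ⟨j, ?_⟩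
  rwa [hk, FO.toID_subst_inst, snoc_comp (fun i => (obj (e i) : L.Term (α ⊕ Fin 0))) σ j] at hj

end Henkin

/-! ## The term structure -/

section TermStructure

variable {L : FirstOrder.Language.{u, v}} {α : Type w}

theorem MaximalConsistent.ex_mem_of_fill {T : Set (IDFormula L α 0)} (hT : MaximalConsistent T)
    {n : ℕ} {s : Fin n → L.Term (α ⊕ Fin 0)} (t : L.Term (α ⊕ Fin 0)) {φ : FO L α (n + 1)}
    (h : FO.toID (FO.subst (Subst.fill (Fin.snoc s t : Fin (n + 1) → L.Term (α ⊕ Fin 0))) φ) ∈ T) :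
    FO.toID (FO.subst (Subst.fill s) (.ex φ)) ∈ T := by
  rw [← FO.toID_subst_inst] at h
  exact hT.ex_mem_of_inst t h

theorem MaximalConsistent.fill_mem_of_all {T : Set (IDFormula L α 0)} (hT : MaximalConsistent T)
    {n : ℕ} {s : Fin n → L.Term (α ⊕ Fin 0)} (t : L.Term (α ⊕ Fin 0)) {φ : FO L α (n + 1)}
    (h : FO.toID (FO.subst (Subst.fill s) (.all φ)) ∈ T) :
    FO.toID (FO.subst (Subst.fill (Fin.snoc s t : Fin (n + 1) → L.Term (α ⊕ Fin 0))) φ) ∈ T := by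
  rw [← FO.toID_subst_inst]
  exact hT.inst_mem_of_all t h

/-- `M` is a structure, with valuation `v` and elements `cl i` named by the object symbols `e i`,
that satisfies exactly the equations and propositional symbols of `T`. -/
structure IsTermStructure (T : Set (IDFormula L α 0)) (e : ℕ → α) (M : Type x) [L.Structure M]
    (v : α → M) (cl : ℕ → M) : Prop where
  surjective : Function.Surjective cl
  eq_iff : ∀ i j, cl i = cl j ↔ Formula.eq (obj (e i)) (obj (e j)) ∈ T
  val : ∀ i, v (e i) = cl i
  funMap : ∀ {k : ℕ} (f : L.Functions k) (σ : Fin k → ℕ) (j : ℕ),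
    Formula.eq (.func f fun i => obj (e (σ i))) (obj (e j)) ∈ T →
      FirstOrder.Language.Structure.funMap f (fun i => cl (σ i)) = cl j
  relMap : ∀ (P : L.Relations 0) (ts : Fin 0 → L.Term (α ⊕ Fin 0)) (a : Fin 0 → M),
    FirstOrder.Language.Structure.RelMap P a ↔ Formula.rel P ts ∈ T

theorem exists_isTermStructure [Infinite α] {T : Set (IDFormula L α 0)}
    (hT : MaximalConsistent T) (e : ℕ → α) :
    ∃ (M : Type x) (_ : Nonempty M) (_ : L.Structure M) (v : α → M) (cl : ℕ → M),
      IsTermStructure T e M v cl := by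
  classical
  let s : Setoid ℕ :=
    { r := fun i j => Formula.eq (obj (e i)) (obj (e j)) ∈ T
      iseqv := ⟨fun i => hT.eq_refl_mem _, fun h => hT.eq_symm_mem h,
        fun h h' => hT.eq_trans_mem h h'⟩ }
  let M : Type x := ULift (Quotient s)
  let cl : ℕ → M := fun i => ⟨Quotient.mk s i⟩
  have hcl : ∀ i j, cl i = cl j ↔ Formula.eq (obj (e i)) (obj (e j)) ∈ T := fun i j =>
    ⟨fun h => Quotient.exact (congrArg ULift.down h), fun h => congrArg ULift.up (Quotient.sound h)⟩
  have hsurj : Function.Surjective cl := by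
    rintro ⟨q⟩
    obtain ⟨i, rfl⟩ := Quotient.exists_rep q
    exact ⟨i, rfl⟩
  -- A function value is prescribed only where `T` equates it with a named symbol; elsewhere `cl 0`
  -- is a default that the truth lemma never meets. Independence of the choice of names is the
  -- congruence property `eq_func_mem`.
  let fm : ∀ {k : ℕ}, L.Functions k → (Fin k → M) → M := fun {k} f xs =>
    if h : ∃ j, ∃ σ : Fin k → ℕ, (xs = fun i => cl (σ i)) ∧
        Formula.eq (.func f fun i => obj (e (σ i))) (obj (e j)) ∈ T
    then cl h.choose else cl 0
  let val : α → M := fun a => if h : ∃ i, e i = a then cl h.choose else cl 0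
  let inst : L.Structure M :=
    { funMap := fm
      -- The arguments are ignored, which is harmless because only nullary predicates matter.
      RelMap := fun {k} P _ => ∃ ts : Fin k → L.Term (α ⊕ Fin 0), Formula.rel P ts ∈ T }
  refine ⟨M, ⟨cl 0⟩, inst, val, cl, hsurj, hcl, fun i => ?_, fun {k} f σ j hj => ?_,
    fun P ts a => ⟨?_, fun h => ⟨ts, h⟩⟩⟩
  · have h : ∃ j, e j = e i := ⟨i, rfl⟩
    have : val (e i) = cl h.choose := dif_pos h
    rw [this, hcl, h.choose_spec]
    exact hT.eq_refl_mem _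
  · have h : ∃ j', ∃ σ' : Fin k → ℕ, ((fun i => cl (σ i)) = fun i => cl (σ' i)) ∧
        Formula.eq (.func f fun i => obj (e (σ' i))) (obj (e j')) ∈ T := ⟨j, σ, rfl, hj⟩
    have : fm f (fun i => cl (σ i)) = cl h.choose := dif_pos h
    refine this.trans ((hcl _ _).2 ?_)
    obtain ⟨σ', hσ', hj'⟩ := h.choose_spec
    refine hT.eq_trans_mem (hT.eq_symm_mem hj') (hT.eq_trans_mem (hT.eq_func_mem f fun i => ?_) hj)
    exact (hcl _ _).1 (congrFun hσ' i).symm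
  · rintro ⟨ts', h⟩
    rwa [Subsingleton.elim ts ts']

/-! ### Evaluation of terms and formulas in the term structure -/

namespace IsTermStructure

variable {T : Set (IDFormula L α 0)} {e : ℕ → α} {X : Set (Σ k, FO L α (k + 1))}
  {M : Type x} [L.Structure M] {v : α → M} {cl : ℕ → M}

theorem exists_termVal_eq [Infinite α] (h : IsTermStructure T e M v cl) (hT : MaximalConsistent T)
    (hX : HasWitnesses T e X) {n : ℕ} (σ : Fin n → ℕ) (t : L.Term (α ⊕ Fin n))
    (htX : termWitnesses t ⊆ X) (hte : termFree t ⊆ Set.range e) :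
    ∃ j, termVal v (fun i => cl (σ i)) t = cl j ∧
      Formula.eq (t.subst (Subst.fill fun i => obj (e (σ i)))) (obj (e j)) ∈ T := by
  induction t with
  | var a =>
    rcases a with a | i
    · obtain ⟨j, rfl⟩ := hte rfl
      exact ⟨j, h.val j, hT.eq_refl_mem _⟩
    · exact ⟨σ i, rfl, hT.eq_refl_mem _⟩
  | @func k f ts ih =>
    choose τ hτ hτT using fun i => ih i
      (((Set.subset_iUnion (fun i => termWitnesses (ts i)) i).trans (Set.subset_insert _ _)).trans
        htX) ((Set.subset_iUnion (fun i => termFree (ts i)) i).trans hte)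
    have key : ∀ j, FO.toID (FO.subst (Subst.fill fun i =>
        obj (e ((Fin.snoc τ j : Fin (k + 1) → ℕ) i)))
        (.eq (.func f fun i => bd i.castSucc) (bd (Fin.last k)))) =
          (Formula.eq (.func f fun i => obj (e (τ i))) (obj (e j)) : IDFormula L α 0) := by
      intro j
      simp [FO.subst, Formula.subst, FO.toID, FirstOrder.Language.Term.subst, bd, Subst.fill]
    have hex := hX ⟨k, _⟩ (htX (Set.mem_insert _ _)) τ ?_
    · obtain ⟨j, hj⟩ := hex
      rw [key] at hj
      refine ⟨j, ?_, hT.eq_trans_mem (hT.eq_func_mem f hτT) hj⟩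
      rw [← h.funMap f τ j hj, ← funext hτ]
      rfl
    -- The formula `∃y f(x̄) = y` is in `T` by reflexivity, with the term `f(x̄)` itself as
    -- instance.
    · refine hT.ex_mem_of_fill (.func f fun i => obj (e (τ i))) ?_
      have : FO.toID (FO.subst (Subst.fill (Fin.snoc (fun i => obj (e (τ i)))
          (.func f fun i => obj (e (τ i))) : Fin (k + 1) → L.Term (α ⊕ Fin 0)))
          (.eq (.func f fun i => bd i.castSucc) (bd (Fin.last k)))) =
            (Formula.eq (.func f fun i => obj (e (τ i))) (.func f fun i => obj (e (τ i))) :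
              IDFormula L α 0) := by
        simp [FO.subst, Formula.subst, FO.toID, FirstOrder.Language.Term.subst, bd, Subst.fill]
      rw [this]
      exact hT.eq_refl_mem _

/-- The truth lemma. -/
theorem holds_iff [Infinite α] (h : IsTermStructure T e M v cl) (hT : MaximalConsistent T)
    (hX : HasWitnesses T e X) {n : ℕ} (φ : FO L α n) (hφX : FO.witnesses φ ⊆ X)
    (hφe : FO.free φ ⊆ Set.range e) (hφ : φ.NullaryPreds) (σ : Fin n → ℕ) :
    FO.Holds v (predInt L M) (predInt L M) φ (fun i => cl (σ i)) ↔
      FO.toID (FO.subst (Subst.fill fun i => obj (e (σ i))) φ) ∈ T := by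
  induction φ with
  | top => exact iff_of_true trivial hT.top_mem
  | bot => exact iff_of_false id hT.bot_notMem
  | rel P ts => cases hφ; exact h.relMap P _ _
  | eq t s =>
    obtain ⟨i, hi, hiT⟩ := h.exists_termVal_eq hT hX σ t (Set.subset_union_left.trans hφX)
      (Set.subset_union_left.trans hφe)
    obtain ⟨j, hj, hjT⟩ := h.exists_termVal_eq hT hX σ s (Set.subset_union_right.trans hφX)
      (Set.subset_union_right.trans hφe)
    change _ = _ ↔ Formula.eq _ _ ∈ T
    rw [hi, hj, h.eq_iff]
    exact ⟨fun H => hT.eq_trans_mem hiT (hT.eq_trans_mem H (hT.eq_symm_mem hjT)),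
      fun H => hT.eq_trans_mem (hT.eq_symm_mem hiT) (hT.eq_trans_mem H hjT)⟩
  | neg φ ih => exact (not_congr (ih hφX hφe hφ σ)).trans hT.neg_mem_iff.symm
  | and φ ψ ih₁ ih₂ =>
    exact (and_congr
      (ih₁ (Set.subset_union_left.trans hφX) (Set.subset_union_left.trans hφe) hφ.1 σ)
      (ih₂ (Set.subset_union_right.trans hφX) (Set.subset_union_right.trans hφe) hφ.2 σ)).trans
      hT.and_mem_iff.symm
  | or φ ψ ih₁ ih₂ =>
    exact (or_congr
      (ih₁ (Set.subset_union_left.trans hφX) (Set.subset_union_left.trans hφe) hφ.1 σ)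
      (ih₂ (Set.subset_union_right.trans hφX) (Set.subset_union_right.trans hφe) hφ.2 σ)).trans
      hT.or_mem_iff.symm
  | imp φ ψ ih₁ ih₂ =>
    exact (imp_congr
      (ih₁ (Set.subset_union_left.trans hφX) (Set.subset_union_left.trans hφe) hφ.1 σ)
      (ih₂ (Set.subset_union_right.trans hφX) (Set.subset_union_right.trans hφe) hφ.2 σ)).trans
      hT.imp_mem_iff.symm
  | iff φ ψ ih₁ ih₂ =>
    have h₁ := ih₁ (Set.subset_union_left.trans hφX) (Set.subset_union_left.trans hφe) hφ.1 σ
    have h₂ := ih₂ (Set.subset_union_right.trans hφX) (Set.subset_union_right.trans hφe) hφ.2 σ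
    exact (and_congr (imp_congr h₁ h₂) (imp_congr h₂ h₁)).trans hT.iff_mem_iff.symm
  | @all n φ ih =>
    have ih' := ih ((Set.subset_insert _ _).trans hφX) hφe hφ
    constructor
    · intro H
      by_contra hcon
      -- A universal formula missing from `T` yields `∃¬φ` in `T`, whose witness names a
      -- counterexample.
      obtain ⟨j, hj⟩ := hX ⟨n, .neg φ⟩ (hφX (Set.mem_insert _ _)) σ
        (hT.ex_neg_mem_of_all_notMem hcon)
      refine hT.neg_mem_iff.1 hj ((ih' _).1 ?_)
      have := H (cl j)
      rwa [snoc_comp cl σ j] at this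
    · intro H a
      obtain ⟨j, rfl⟩ := h.surjective a
      have := hT.fill_mem_of_all (obj (e j)) H
      rw [snoc_comp (fun i => (obj (e i) : L.Term (α ⊕ Fin 0))) σ j] at this
      rw [snoc_comp cl σ j]
      exact (ih' _).2 this
  | @ex n φ ih =>
    have ih' := ih ((Set.subset_insert _ _).trans hφX) hφe hφ
    constructor
    · rintro ⟨a, H⟩
      obtain ⟨j, rfl⟩ := h.surjective a
      refine hT.ex_mem_of_fill (obj (e j)) ?_
      rw [snoc_comp (fun i => (obj (e i) : L.Term (α ⊕ Fin 0))) σ j]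
      refine (ih' _).1 ?_
      rwa [snoc_comp cl σ j] at H
    · intro H
      obtain ⟨j, hj⟩ := hX ⟨n, φ⟩ (hφX (Set.mem_insert _ _)) σ H
      refine ⟨cl j, ?_⟩
      rw [snoc_comp cl σ j]
      exact (ih' _).2 hj
  | defn d => exact d.elim

theorem sat_iff_of_isPropositional (h : IsTermStructure T e M v cl) (hT : MaximalConsistent T)
    {φ : IDFormula L α 0} (hφ : φ.IsPropositional) :
    IDFormula.Sat v φ Fin.elim0 ↔ φ ∈ T := by
  -- The level is an index of the inductive family, so it is generalized before the induction.
  suffices H : ∀ {n : ℕ} (φ : IDFormula L α n) (hn : n = 0), φ.IsPropositional →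
      ∀ xs : Fin n → M, (IDFormula.Sat v φ xs ↔ hn ▸ φ ∈ T) from H φ rfl hφ _
  intro n φ hn hφ xs
  induction φ with
  | top => subst hn; exact iff_of_true trivial hT.top_mem
  | bot => subst hn; exact iff_of_false id hT.bot_notMem
  | rel P ts => subst hn; cases hφ; exact h.relMap P _ _
  | eq t s => exact hφ.elim
  | neg φ ih => subst hn; exact (not_congr (ih rfl hφ xs)).trans hT.neg_mem_iff.symm
  | and φ ψ ih₁ ih₂ =>
    subst hn; exact (and_congr (ih₁ rfl hφ.1 xs) (ih₂ rfl hφ.2 xs)).trans hT.and_mem_iff.symm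
  | or φ ψ ih₁ ih₂ =>
    subst hn; exact (or_congr (ih₁ rfl hφ.1 xs) (ih₂ rfl hφ.2 xs)).trans hT.or_mem_iff.symm
  | imp φ ψ ih₁ ih₂ =>
    subst hn; exact (imp_congr (ih₁ rfl hφ.1 xs) (ih₂ rfl hφ.2 xs)).trans hT.imp_mem_iff.symm
  | iff φ ψ ih₁ ih₂ =>
    subst hn
    exact (iff_congr (ih₁ rfl hφ.1 xs) (ih₂ rfl hφ.2 xs)).trans
      (iff_iff_implies_and_implies.trans hT.iff_mem_iff.symm)
  | all φ ih => exact hφ.elim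
  | ex φ ih => exact hφ.elim
  | defn d => exact hφ.elim

end IsTermStructure

end TermStructure

/-! ## Stability of the term structure -/

section Stability

variable {L : FirstOrder.Language.{u, v}} {α : Type w}

theorem append_elim0_comp {β γ : Type*} (g : β → γ) {k : ℕ} (y : Fin k → β) :
    Fin.append Fin.elim0 (fun i => g (y i)) = fun i => g (Fin.append Fin.elim0 y i) := by
  funext i
  refine Fin.addCases (fun i => i.elim0) (fun j => ?_) i
  rw [Fin.append_right, Fin.append_right]

theorem Definition.stepOp_mono {M : Type x} [L.Structure M] {n : ℕ} (Φ : Definition L α n)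
    (v : α → M) (xs : Fin n → M) {I J K : PredInt L M} (h : I ≤ J) :
    Φ.stepOp v xs I K ≤ Φ.stepOp v xs J K := by
  rintro k P a (⟨hP, m, args, body, hr, b, hb, hbody⟩ | hP)
  · exact .inl ⟨hP, m, args, body, hr, b, hb, hbody.mono h le_rfl⟩
  · exact .inr hP

theorem exists_fresh_tuple [Infinite α] {B : Set α} (hB : B.Finite) (m : ℕ) :
    ∃ y : Fin m → α, Function.Injective y ∧ ∀ i, y i ∉ B := by
  have f := hB.infinite_compl.natEmbedding
  exact ⟨fun i => f i, fun i j h => Fin.ext (f.injective (Subtype.ext h)), fun i => (f i).2⟩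

theorem Definition.free_body_subset {n : ℕ} {Φ : Definition L α n} {r : Rule L α n} (hr : r ∈ Φ) :
    FO.free r.body ⊆ Definition.free Φ :=
  Set.subset_union_right.trans (Set.subset_biUnion_of_mem (u := fun r => Rule.free r) hr)

/-- The formula stating that the body of `r` is satisfiable when the positive occurrences of the
defined predicates of `Φ` are given the truth values in `K`. -/
noncomputable def Definition.trueBody (Φ : Definition L α 0) (K : Set (PredSym L))
    (r : Rule L α 0) : FO L α 0 :=
  FO.exs r.numVars (FO.replacePos Φ.defined (truthValue K) true r.body)

/-- Formulas whose witnesses guarantee the stability of `Φ` in term structures. -/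
noncomputable def Definition.witnesses (Φ : Definition L α 0) : Set (Σ k, FO L α (k + 1)) :=
  ⋃ r ∈ Φ, (FO.witnesses r.body ∪ ⋃ K ∈ 𝒫 Φ.defined, FO.witnesses (Φ.trueBody K r))

theorem Definition.defined_finite {n : ℕ} (Φ : Definition L α n) : Φ.defined.Finite :=
  Φ.finite_toSet.image Rule.sym

/-- The prefixed point to be excluded is known only after `T` has been built, so witnesses are
provided in advance for every subset `K` of the defined predicates; there are finitely many of
these. -/
theorem Definition.witnesses_finite (Φ : Definition L α 0) : Φ.witnesses.Finite :=
  Φ.finite_toSet.biUnion fun r _ => (FO.witnesses_finite r.body).union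
    (Φ.defined_finite.powerset.biUnion fun _ _ => FO.witnesses_finite _)

/-- An atom is refuted by induction from its falsity in a prefixed point described by `K`. -/
theorem Provable.of_refuted_bodies [Infinite α] {Φ : Definition L α 0} {K : Set (PredSym L)} {k : ℕ}
    {P : L.Relations k} (hP : (⟨k, P⟩ : PredSym L) ∈ Φ.defined) (hPK : (⟨k, P⟩ : PredSym L) ∉ K)
    (args : Fin k → L.Term (α ⊕ Fin 0)) {Γ : Set (IDFormula L α 0)} (hΓ : (freeSet Γ).Finite)
    (hbody : ∀ r ∈ Φ, r.sym ∉ K →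
      Formula.neg (FO.toID (FO.subst (Subst.fill Fin.elim0) (Φ.trueBody K r))) ∈ Γ) :
    Provable (insert (.rel P args) (insert (.defn Φ) Γ)) ∅ := by
  choose y hinj hfresh using fun r : Rule L α 0 =>
    exists_fresh_tuple (hΓ.union (Definition.free_finite Φ)) r.numVars
  refine .defL Φ Φ.defined subset_rfl (truthValue K) hP args y (fun r _ _ => hinj r)
    (fun r _ _ i => ?_) (fun r _ _ i q _ => ?_) (fun r hr _ => ?_) ?_
  · simpa [freeSet] using hfresh r i
  · rw [free_truthValue]
    exact Set.notMem_empty _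
  · by_cases hrK : r.sym ∈ K
    · rw [truthValue_of_mem hrK]
      exact .ax (.inr (.inr (Set.mem_insert _ _)))
    -- The instance of the replaced body at the eigenvariables implies its existential closure,
    -- whose negation is in `Γ`.
    · have h := Provable.exsR (Γ := ∅) (Δ := ∅) r.numVars
        (FO.replacePos Φ.defined (truthValue K) true r.body) Fin.elim0 fun i => obj (y r i)
      rw [← Subst.inst_eq_fill] at h
      refine .wk ?_ (Set.empty_subset _) h.negL
      refine Set.insert_subset (.inr (.inr (hbody r hr hrK))) (Set.insert_subset (.inl rfl) ?_)
      exact Set.empty_subset _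
  · rw [truthValue_of_notMem hPK]
    exact .ax (.inr (.inl (Set.mem_insert _ _)))

/-! ### The term structure as least prefixed point -/

namespace IsTermStructure

variable {T : Set (IDFormula L α 0)} {e : ℕ → α} {X : Set (Σ k, FO L α (k + 1))}
  {M : Type x} [L.Structure M] {v : α → M} {cl : ℕ → M}

theorem stepOp_le [Infinite α] (h : IsTermStructure T e M v cl) (hT : MaximalConsistent T)
    (hX : HasWitnesses T e X) {Φ : Definition L α 0} (hΦ : Φ.IsPropositional)
    (hΦT : Formula.defn Φ ∈ T) (hΦX : Φ.witnesses ⊆ X) (hΦe : Φ.free ⊆ Set.range e) :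
    Φ.stepOp v Fin.elim0 (predInt L M) (predInt L M) ≤ predInt L M := by
  rintro k P a (⟨-, m, args, body, hr, b, -, hbody⟩ | ⟨-, hP⟩)
  · obtain rfl : k = 0 := (hΦ _ hr).1
    choose y hy using fun i => h.surjective (b i)
    obtain rfl : (fun i => cl (y i)) = b := funext hy
    have hbodyX : FO.witnesses body ⊆ X :=
      (Set.subset_union_left.trans (Set.subset_biUnion_of_mem (u := fun r : Rule L α 0 =>
        FO.witnesses r.body ∪ ⋃ K ∈ 𝒫 Φ.defined, FO.witnesses (Φ.trueBody K r)) hr)).trans hΦX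
    have hbodyT := (h.holds_iff hT hX body hbodyX
      ((Definition.free_body_subset hr).trans hΦe) (hΦ _ hr).2 (Fin.append Fin.elim0 y)).1
        (by rwa [append_elim0_comp cl y] at hbody)
    rw [← append_elim0_comp (fun i => (obj (e i) : L.Term (α ⊕ Fin 0))) y,
      ← Subst.inst_eq_fill] at hbodyT
    exact (h.relMap P _ a).2 (hT.mem_of_mem_of_mem hΦT hbodyT
      (.defR hr (fun i => e (y i)) (.id _ (Set.mem_insert_of_mem _ (Set.mem_insert _ _))
        (Set.mem_insert _ _))))
  · exact hP

theorem le_of_stepOp_le [Infinite α] (h : IsTermStructure T e M v cl) (hT : MaximalConsistent T)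
    (hX : HasWitnesses T e X) {Φ : Definition L α 0} (hΦ : Φ.IsPropositional)
    (hΦT : Formula.defn Φ ∈ T) (hΦX : Φ.witnesses ⊆ X) (hΦe : Φ.free ⊆ Set.range e)
    {K : PredInt L M} (hctx : Φ.SameContext K (predInt L M))
    (hK : Φ.stepOp v Fin.elim0 K (predInt L M) ≤ K) : predInt L M ≤ K := by
  intro k P a hI
  by_cases hP : (⟨k, P⟩ : PredSym L) ∈ Φ.defined
  swap
  · rwa [hctx k P hP]
  have hzero : ∀ {k : ℕ} {P : L.Relations k}, (⟨k, P⟩ : PredSym L) ∈ Φ.defined → k = 0 := by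
    rintro k P ⟨r, hr, hrP⟩
    exact (congrArg Sigma.fst hrP).symm.trans (hΦ r hr).1
  -- The argument `cl 0` is a dummy: defined predicates have arity `0`, so there is only one tuple.
  let K' : Set (PredSym L) := {p ∈ Φ.defined | K p.1 p.2 fun _ => cl 0}
  have hKK' : ∀ {k : ℕ} (P : L.Relations k) (a : Fin k → M), (⟨k, P⟩ : PredSym L) ∈ Φ.defined →
      (K k P a ↔ (⟨k, P⟩ : PredSym L) ∈ K') := by
    intro k P a hP
    obtain rfl := hzero hP
    rw [Subsingleton.elim a fun _ => cl 0]
    exact ⟨fun h => ⟨hP, h⟩, fun h => h.2⟩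
  by_contra hPK
  rw [hKK' P a hP] at hPK
  obtain rfl := hzero hP
  let θ : Rule L α 0 → IDFormula L α 0 := fun r =>
    .neg (FO.toID (FO.subst (Subst.fill Fin.elim0) (Φ.trueBody K' r)))
  have hfin : (θ '' {r | r ∈ Φ ∧ r.sym ∉ K'}).Finite :=
    (Φ.finite_toSet.subset fun r hr => hr.1).image θ
  -- If a closed body were in `T`, it would be true in the structure by the truth lemma, and
  -- prefixedness of `K` would put the head of the rule into `K'`.
  have hsub : θ '' {r | r ∈ Φ ∧ r.sym ∉ K'} ⊆ T := by
    rintro _ ⟨r, ⟨hr, hrK⟩, rfl⟩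
    refine hT.neg_mem_iff.2 fun hθ => hrK ?_
    have hrX : FO.witnesses (Φ.trueBody K' r) ⊆ X :=
      ((Set.subset_biUnion_of_mem (u := fun K => FO.witnesses (Φ.trueBody K r))
        (show K' ∈ 𝒫 Φ.defined from fun p hp => hp.1)).trans (Set.subset_union_right.trans
          (Set.subset_biUnion_of_mem (u := fun r : Rule L α 0 =>
            FO.witnesses r.body ∪ ⋃ K ∈ 𝒫 Φ.defined, FO.witnesses (Φ.trueBody K r)) hr))).trans hΦX
    have hre : FO.free (Φ.trueBody K' r) ⊆ Set.range e := by
      rw [Definition.trueBody, FO.free_exs]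
      exact (FO.free_replacePos_truthValue _ _ _ _).trans
        ((Definition.free_body_subset hr).trans hΦe)
    have hholds := (h.holds_iff hT hX (Φ.trueBody K' r) hrX hre (FO.nullaryPreds_exs _
      (FO.nullaryPreds_replacePos_truthValue _ _ _ (hΦ r hr).2)) Fin.elim0).2
        (by rwa [Subsingleton.elim (fun i : Fin 0 => obj (e (Fin.elim0 i))) Fin.elim0])
    obtain ⟨b, hb⟩ := (FO.holds_exs _ _ _ _ _ _).1 hholds
    rw [(FO.holds_replacePos_truthValue v hKK'
      (fun P a hP => by rw [hctx _ P hP]) r.body _).1, Subsingleton.elim (fun i : Fin 0 =>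
        cl (Fin.elim0 i)) Fin.elim0] at hb
    have hdef : (⟨r.arity, r.pred⟩ : PredSym L) ∈ Φ.defined := ⟨r, hr, rfl⟩
    have : IsEmpty (Fin r.arity) := by
      rw [(hΦ r hr).1]
      infer_instance
    exact (hKK' r.pred isEmptyElim hdef).1 (hK _ _ _ (.inl ⟨hdef, r.numVars, r.args, r.body, hr, b,
      isEmptyElim, hb⟩))
  have hfree : (freeSet (θ '' {r | r ∈ Φ ∧ r.sym ∉ K'})).Finite :=
    hfin.biUnion fun φ _ => IDFormula.free_finite φ
  exact hT.notMem_of_provable (Set.insert_subset hΦT hsub) (hfin.insert _)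
    (Provable.of_refuted_bodies hP hPK Fin.elim0 hfree fun r hr hrK => ⟨r, ⟨hr, hrK⟩, rfl⟩)
    ((h.relMap P _ a).1 hI)

theorem isStable [Infinite α] (h : IsTermStructure T e M v cl) (hT : MaximalConsistent T)
    (hX : HasWitnesses T e X) {Φ : Definition L α 0} (hΦ : Φ.IsPropositional)
    (hΦT : Formula.defn Φ ∈ T) (hΦX : Φ.witnesses ⊆ X) (hΦe : Φ.free ⊆ Set.range e) :
    Φ.IsStable v Fin.elim0 (predInt L M) := by
  have hpre := h.stepOp_le hT hX hΦ hΦT hΦX hΦe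
  refine ⟨⟨fun _ _ _ => rfl, le_antisymm hpre ?_⟩, fun K hK =>
    h.le_of_stepOp_le hT hX hΦ hΦT hΦX hΦe hK.1 hK.2.le⟩
  -- Knaster–Tarski: by monotonicity the image of the prefixed point is again prefixed, so it
  -- contains the least one.
  refine h.le_of_stepOp_le hT hX hΦ hΦT hΦX hΦe (fun k P hP => ?_) (Φ.stepOp_mono v _ hpre)
  funext a
  exact propext ⟨fun H => hpre k P a H, fun H => .inr ⟨hP, H⟩⟩

end IsTermStructure

end Stability

/-! ## Completeness -/

section Completeness

variable {L : FirstOrder.Language.{u, v}} {α : Type w}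

/-- Each `¬δ` is cut away: with `δ` in `Δ`, the sequent `Γ ⊢ ¬δ, Δ` follows from an axiom by the
right rule for negation. -/
theorem Provable.of_negations {Γ Δ Δ₀ : Set (IDFormula L α 0)} (hfin : Δ₀.Finite) (hΔ₀ : Δ₀ ⊆ Δ)
    (h : Provable (Γ ∪ Formula.neg '' Δ₀) Δ) : Provable Γ Δ := by
  induction Δ₀, hfin using Set.Finite.induction_on with
  | empty => simpa using h
  | @insert δ Δ₁ _ _ ih =>
    rw [Set.insert_subset_iff] at hΔ₀
    refine ih hΔ₀.2 (.cut (.neg δ) (.negR ?_) ?_)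
    · exact .id δ (Set.mem_insert _ _) hΔ₀.1
    · rwa [Set.image_insert_eq, Set.union_insert] at h

theorem Provable.of_inconsistent {Γ Δ : Set (IDFormula L α 0)}
    (h : Inconsistent (Γ ∪ Formula.neg '' Δ)) : Provable Γ Δ := by
  obtain ⟨T₀, hT₀, hfin, h⟩ := h
  have hinj : Function.Injective (Formula.neg : IDFormula L α 0 → IDFormula L α 0) :=
    fun _ _ h => Formula.neg.inj h
  refine .of_negations (Δ₀ := Δ ∩ Formula.neg ⁻¹' T₀)
    ((hfin.preimage hinj.injOn).subset Set.inter_subset_right) Set.inter_subset_left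
    (.wk (fun φ hφ => ?_) (Set.empty_subset _) h)
  rcases hT₀ hφ with hΓ | ⟨δ, hδ, rfl⟩
  · exact .inl hΓ
  · exact .inr ⟨δ, ⟨hδ, hφ⟩, rfl⟩

end Completeness

end FOID

theorem mainTheorem3 {L : FirstOrder.Language.{u, v}} {α : Type w} [Infinite α]
    (Γ Δ : Set (FOID.IDFormula L α 0))
    (hΓ : ∀ φ ∈ Γ, FOID.Formula.IsPropositional φ)
    (hΔ : ∀ φ ∈ Δ, FOID.Formula.IsPropositional φ)
    (n : ℕ) (Φ : Fin n → FOID.Definition L α 0)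
    (hΦ : ∀ i, FOID.Definition.IsPropositional (Φ i))
    (hvalid : FOID.StableValid (Γ ∪ Set.range fun i => FOID.Formula.defn (Φ i)) Δ) :
    FOID.Provable (Γ ∪ Set.range fun i => FOID.Formula.defn (Φ i)) Δ := by
  by_contra hcon
  have hcons := mt FOID.Provable.of_inconsistent hcon
  have hfree : (⋃ i, FOID.Definition.free (Φ i)).Finite :=
    Set.finite_iUnion fun i => FOID.Definition.free_finite _
  have hfin : (FOID.freeSet ((Γ ∪ Set.range fun i => FOID.Formula.defn (Φ i)) ∪
      FOID.Formula.neg '' Δ)).Finite := by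
    refine hfree.subset (Set.iUnion₂_subset ?_)
    rintro φ ((hφ | ⟨i, rfl⟩) | ⟨δ, hδ, rfl⟩)
    · exact (hΓ φ hφ).free_eq_empty.trans_subset (Set.empty_subset _)
    · exact Set.subset_iUnion (fun i => FOID.Definition.free (Φ i)) i
    · exact ((hΔ δ hδ).free_eq_empty : FOID.IDFormula.free δ = ∅).trans_subset
        (Set.empty_subset _)
  -- The names must include the free symbols of the definitions, for the truth lemma, and form an
  -- infinite set, for fresh witnesses.
  obtain ⟨e, he⟩ := (hfree.countable.union
    (Set.countable_range (Infinite.natEmbedding α))).exists_eq_range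
      ((Set.range_nonempty _).mono Set.subset_union_right)
  have heinf : (Set.range e).Infinite := he ▸
    (Set.infinite_range_of_injective (Infinite.natEmbedding α).injective).mono
      Set.subset_union_right
  have hfe : ∀ i, FOID.Definition.free (Φ i) ⊆ Set.range e := fun i =>
    ((Set.subset_iUnion (fun i => FOID.Definition.free (Φ i)) i).trans
      Set.subset_union_left).trans he.subset
  obtain ⟨T, hbase, hT, hX⟩ := FOID.exists_hasWitnesses hcons hfin heinf
    (X := ⋃ i, (Φ i).witnesses)
    (Set.finite_iUnion fun i => FOID.Definition.witnesses_finite (Φ i)).countable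
  obtain ⟨M, hne, hM, v, cl, h⟩ := FOID.exists_isTermStructure.{u, v, w, max u v w} hT e
  obtain ⟨δ, hδ, hsat⟩ := hvalid M v (by
    rintro φ (hφ | ⟨i, rfl⟩)
    · exact (h.sat_iff_of_isPropositional hT (hΓ φ hφ)).2 (hbase (.inl (.inl hφ)))
    · exact h.isStable hT hX (hΦ i) (hbase (.inl (.inr ⟨i, rfl⟩)))
        (Set.subset_iUnion (fun i => (Φ i).witnesses) i) (hfe i))
  exact hT.neg_mem_iff.1 (hbase (.inr ⟨δ, hδ, rfl⟩))
    ((h.sat_iff_of_isPropositional hT (hΔ δ hδ)).1 hsat)
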